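/- **Setting.** Let $d,m,p\in\mathbb{N}$, $N\ge 1$, $n\ge 1$, and consider $x_{t+1}=A_tx_t+B_tu_t+E_tw_t$ with $x_t\in\mathbb{R}^d$, $u_t\in\mathbb{R}^m$, $w_t\in\mathbb{R}^p$. Put $\boldsymbol{x}=(x_0,\dots,x_{N-1})$, $\boldsymbol{u}=(u_0,\dots,u_{N-1})$, $\boldsymbol{w}=(x_0,w_0,\dots,w_{N-2})\in\mathbb{R}^s$ with $s=d+(N-1)p$; let $Z$ be the block downshift operator, $\mathbf{A}=\mathrm{blkdiag}(A_0,\dots,A_{N-1})$, $\mathbf{B}=\mathrm{blkdiag}(B_0,\dots,B_{N-1})$, $\mathbf{E}=\mathrm{blkdiag}(I,E_0,\dots,E_{N-2})$. A closed-loop map $\Phi=\begin{bmatrix}\Phi_x\\ \Phi_u\end{bmatrix}\in\mathbb{R}^{N(d+m)\times s}$ is *achievable* if $[\,I-Z\mathbf{A}\;\; -Z\mathbf{B}\,]\,\Phi=\mathbf{E}$. A map is *admissible* if it is achievable (first version), or if it is achievable and $\Phi_x,\Phi_u$ are block lower triangular, i.e. causal (second version); the theorem holds for each version. Let $D\succeq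 0$, $\hat w^1,\dots,\hat w^n\in\mathbb{R}^s$, $\hat{\mathbb{P}}_n=\frac1n\sum_i\delta_{\hat w^i}$, $\rho\ge 0$, $\epsilon>0$, and let $\nu=\mathcal{N}(\mu,\Sigma)$ be the Gaussian measure on $\mathbb{R}^s$ with mean $\mu$ and covariance $\Sigma\succ 0$. For a probability measure $\mathbb{P}$ on $\mathbb{R}^s$ let $$W^\epsilon(\hat{\mathbb{P}}_n,\mathbb{P})=\inf_{\gamma\in\Gamma(\hat{\mathbb{P}}_n,\mathbb{P})}\Big\{\mathbb{E}_{(x,y)\sim\gamma}\|x-y\|^2+\epsilon\,\mathrm{KL}\big(\gamma\,\big|\,\hat{\mathbb{P}}_n\times\nu\big)\Big\},$$ where $\Gamma$ denotes the set of couplings, and let $\mathbb{B}_{\rho,\epsilon}=\{\mathbb{P}: W^\epsilon(\hat{\mathbb{P}}_n,\mathbb{P})\le\rho\}$. The Sinkhorn distributionally robust control problem is $$\min_{\Phi\ \text{admissible}} V(\Phi),\qquad V(\Phi)=\sup_{\mathbb{P}\in\mathbb{B}_{\rho,\epsilon}}\mathbb{E}_{\boldsymbol{w}\sim\mathbb{P}}\big[\boldsymbol{w}^\top\Phi^\top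 D\Phi\,\boldsymbol{w}\big].\tag{1}$$ It is feasible if an admissible $\Phi$ exists and $\mathbb{B}_{\rho,\epsilon}\ne\emptyset$. Write $\|\mu\|^2_{\Sigma^{-1}}=\mu^\top\Sigma^{-1}\mu$, $|\cdot|$ for the determinant, and $$\begin{aligned}\rho_{\min}={}&\tfrac{\epsilon}{2}\log\big|\Sigma+\tfrac{\epsilon}{2}I\big|-\tfrac{\epsilon s}{2}\log\tfrac{\epsilon}{2}+\tfrac{\epsilon}{2}\|\mu\|^2_{\Sigma^{-1}}+\tfrac1n\sum_{i=1}^n\|\hat w^i\|^2\\&-\tfrac1n\sum_{i=1}^n\big(\hat w^i+\tfrac{\epsilon}{2}\Sigma^{-1}\mu\big)^\top\big(I+\tfrac{\epsilon}{2}\Sigma^{-1}\big)^{-1}\big(\hat w^i+\tfrac{\epsilon}{2}\Sigma^{-1}\mu\big).\end{aligned}$$ Consider the program in the variables $\lambda\ge 0$, $Q\succeq 0$ of size $s\times s$, $s_i,\zeta_i\in\mathbb{R}$ $(i=1,\dots,n)$, and $\Phi$: $$\begin{aligned}\inf\ &\lambda\rho+\tfrac1n\sum_{i=1}^n s_i\qquad\text{subject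 to, for all } i=1,\dots,n,\\ &M=\lambda\big(I+\tfrac{\epsilon}{2}\Sigma^{-1}\big)-Q\succ 0,\\ &\tfrac{\lambda\epsilon s}{2}\log\tfrac{\lambda\epsilon}{2}-\tfrac{\lambda\epsilon}{2}\log|\Sigma|-\tfrac{\lambda\epsilon}{2}\log|M|+\zeta_i\le s_i,\\ &\begin{bmatrix}M&v_i\\ v_i^\top&\zeta_i+\lambda\|\hat w^i\|^2+\tfrac{\lambda\epsilon}{2}\|\mu\|^2_{\Sigma^{-1}}\end{bmatrix}\succeq 0,\qquad v_i=\lambda\hat w^i+\tfrac{\lambda\epsilon}{2}\Sigma^{-1}\mu,\\ &\begin{bmatrix}Q&(D^{1/2}\Phi)^\top\\ D^{1/2}\Phi&I\end{bmatrix}\succeq 0,\qquad \Phi\ \text{admissible}.\end{aligned}\tag{2}$$ **Theorem.** 1. Problem (1) is feasible if and only if $\rho\ge\rho_{\min}$. 2. Let $\rho\ge\rho_{\min}$. For every admissible $\Phi$, $V(\Phi)$ is finite and equals the infimum of (2) with $\Phi$ held fixed; hence (1) and (2) have the same optimal value. If $(\lambda,Q,(s_i),(\zeta_i),\Phi)$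 is a minimizer of (2), then $\Phi$ is optimal for (1). A map $\Phi$ is optimal for (1) if and only if for every $\delta>0$ it is the $\Phi$-component of a feasible point of (2) whose objective is within $\delta$ of the infimum of (2). If $\rho>\rho_{\min}$ and $\Phi$ is optimal for (1) with $\Phi^\top D\Phi\ne 0$, then $\Phi$ is the $\Phi$-component of a minimizer of (2). 3. The last matrix inequality in (2) is equivalent to $Q\succeq\Phi^\top D\Phi$, and relaxing $Q=\Phi^\top D\Phi$ to it does not change the optimum: adding the constraint $Q=\Phi^\top D\Phi$ to (2) does not change the infimum; every minimizer of (2) becomes a minimizer of the constrained program when $Q$ is replaced by $\Phi^\top D\Phi$; and every minimizer of the constrained program is a minimizer of (2). -/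

import Mathlib

open MeasureTheory
open scoped Matrix ENNReal MatrixOrder

noncomputable section

namespace SinkhornControl

/-! ### Index sets: a pair `(i, t)` stands for component `i` of the vector at time `t` -/

/-- Index set of the stacked states `𝐱 = (x₀, …, x_{N-1})`, with `x_t ∈ ℝᵈ`. -/
abbrev StateIdx (d N : ℕ) : Type := Fin d × Fin N

/-- Index set of the stacked inputs `𝐮 = (u₀, …, u_{N-1})`, with `u_t ∈ ℝᵐ`. -/
abbrev InputIdx (m N : ℕ) : Type := Fin m × Fin N

/-- Index set of the stacked disturbances `𝐰 = (x₀, w₀, …, w_{N-2})`, with `x₀ ∈ ℝᵈ` and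
`w_t ∈ ℝᵖ`. Its cardinality is `s = d + (N - 1) p`. -/
abbrev NoiseIdx (d p N : ℕ) : Type := Fin d ⊕ Fin p × Fin (N - 1)

/-- The space `𝒵 = ℝˢ` of disturbance trajectories, with the Euclidean norm. -/
abbrev Noise (d p N : ℕ) : Type := EuclideanSpace ℝ (NoiseIdx d p N)

/-- System-level closed-loop maps `Φ = [Φₓ; Φᵤ] ∈ ℝ^{N(d+m) × s}`. -/
abbrev ClosedLoopMap (d m p N : ℕ) : Type :=
  Matrix (StateIdx d N ⊕ InputIdx m N) (NoiseIdx d p N) ℝ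

/-! ### The dynamics in block form and the system level constraint -/

/-- The block downshift operator: identity blocks on the first block sub-diagonal. -/
def downshift (d N : ℕ) : Matrix (StateIdx d N) (StateIdx d N) ℝ :=
  Matrix.of fun a b => if (a.2 : ℕ) = (b.2 : ℕ) + 1 ∧ a.1 = b.1 then 1 else 0

/-- `blkdiag (I, E₀, …, E_{N-2})`, which maps `𝐰 = (x₀, w₀, …, w_{N-2})` to the stacked state
space: `x₀` enters at time `0` and `E_k w_k` at time `k + 1`. -/
def noiseInput {d p N : ℕ} (E : Fin N → Matrix (Fin d) (Fin p) ℝ) :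
    Matrix (StateIdx d N) (NoiseIdx d p N) ℝ :=
  Matrix.of fun a => Sum.elim
    (fun j => if (a.2 : ℕ) = 0 ∧ a.1 = j then 1 else 0)
    (fun jk => if (a.2 : ℕ) = (jk.2 : ℕ) + 1
      then E (Fin.castLE (Nat.sub_le N 1) jk.2) a.1 jk.1 else 0)

/-- Achievability: `[I - Z𝐀   -Z𝐁] Φ = 𝐄`. -/
def IsAchievable {d m p N : ℕ} (A : Fin N → Matrix (Fin d) (Fin d) ℝ)
    (B : Fin N → Matrix (Fin d) (Fin m) ℝ) (E : Fin N → Matrix (Fin d) (Fin p) ℝ)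
    (Φ : ClosedLoopMap d m p N) : Prop :=
  Matrix.fromCols (1 - downshift d N * Matrix.blockDiagonal A)
    (-(downshift d N * Matrix.blockDiagonal B)) * Φ = noiseInput E

/-- `Φₓ` and `Φᵤ` are block lower triangular: the disturbance `w_k`, which enters the state at
time `k + 1`, does not act on states and inputs at times `t ≤ k`. -/
def IsCausal {d m p N : ℕ} (Φ : ClosedLoopMap d m p N) : Prop :=
  ∀ (t : Fin N) (k : Fin (N - 1)) (j : Fin p), (t : ℕ) < (k : ℕ) + 1 →
    (∀ i : Fin d, Φ (Sum.inl (i, t)) (Sum.inr (j, k)) = 0) ∧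
    (∀ i : Fin m, Φ (Sum.inr (i, t)) (Sum.inr (j, k)) = 0)

/-! ### Probability: empirical and Gaussian measures, Sinkhorn discrepancy and ambiguity set -/

/-- The empirical measure `n⁻¹ ∑ᵢ δ_{wᵢ}` of `n ≥ 1` points. -/
def empirical {𝒵 : Type*} [MeasurableSpace 𝒵] {n : ℕ} (w : Fin n → 𝒵) : Measure 𝒵 :=
  (n : ℝ≥0∞)⁻¹ • ∑ i, Measure.dirac (w i)

/-- The measure with Lebesgue density
`((2π)ˢ |Σ|)^{-1/2} exp (-(ξ - μ)ᵀ Σ⁻¹ (ξ - μ) / 2)` on `ℝ^ι`, where `s = |ι|`. -/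
def gaussian {ι : Type*} [Fintype ι] [DecidableEq ι] (mean : EuclideanSpace ℝ ι)
    (Sigma : Matrix ι ι ℝ) : Measure (EuclideanSpace ℝ ι) :=
  volume.withDensity fun ξ => ENNReal.ofReal
    ((√((2 * Real.pi) ^ Fintype.card ι * Sigma.det))⁻¹ *
      Real.exp (-(1 / 2) * ((ξ - mean).ofLp ⬝ᵥ (Sigma⁻¹ *ᵥ (ξ - mean).ofLp))))

/-- `γ` is a coupling of `P` and `Q`. -/
def IsCoupling {𝒵 : Type*} [MeasurableSpace 𝒵] (γ : Measure (𝒵 × 𝒵)) (P Q : Measure 𝒵) : Prop :=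
  γ.map Prod.fst = P ∧ γ.map Prod.snd = Q

/-- The Sinkhorn discrepancy between `P` and `Q` for the cost `c(x, y) = ‖x - y‖²`,
with reference measures `P` (for the first marginal) and `ν` (for the second marginal):
the infimum of `𝔼_γ[c] + ε KL(γ | P × ν)` over all couplings `γ` of `P` and `Q`. -/
def sinkhorn {𝒵 : Type*} [NormedAddCommGroup 𝒵] [MeasurableSpace 𝒵] (ε : ℝ)
    (ν P Q : Measure 𝒵) : ℝ≥0∞ :=
  ⨅ (γ : Measure (𝒵 × 𝒵)) (_ : IsCoupling γ P Q),
    (∫⁻ z, ENNReal.ofReal (‖z.1 - z.2‖ ^ 2) ∂γ) +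
      ENNReal.ofReal ε * InformationTheory.klDiv γ (P.prod ν)

/-- The Sinkhorn ambiguity set of radius `ρ` centred at `P`. -/
def ambiguitySet {𝒵 : Type*} [NormedAddCommGroup 𝒵] [MeasurableSpace 𝒵] (ρ ε : ℝ)
    (ν P : Measure 𝒵) : Set (Measure 𝒵) :=
  {Q | IsProbabilityMeasure Q ∧ sinkhorn ε ν P Q ≤ ENNReal.ofReal ρ}

/-! ### The distributionally robust control problem -/

/-- The data of the problem. -/
structure Data (d m p N n : ℕ) where
  /-- state matrices -/
  A : Fin N → Matrix (Fin d) (Fin d) ℝ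
  /-- input matrices -/
  B : Fin N → Matrix (Fin d) (Fin m) ℝ
  /-- disturbance matrices -/
  E : Fin N → Matrix (Fin d) (Fin p) ℝ
  /-- cost matrix -/
  D : Matrix (StateIdx d N ⊕ InputIdx m N) (StateIdx d N ⊕ InputIdx m N) ℝ
  /-- sampled disturbance trajectories -/
  w : Fin n → Noise d p N
  /-- mean of the reference measure -/
  mean : Noise d p N
  /-- covariance of the reference measure -/
  Sigma : Matrix (NoiseIdx d p N) (NoiseIdx d p N) ℝ
  /-- radius -/
  ρ : ℝ
  /-- regularization parameter -/
  ε : ℝ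

variable {d m p N n : ℕ}

/-- The Sinkhorn ambiguity set around the empirical measure, with Gaussian reference measure. -/
def Data.ball (pb : Data d m p N n) : Set (Measure (Noise d p N)) :=
  ambiguitySet pb.ρ pb.ε (gaussian pb.mean pb.Sigma) (empirical pb.w)

/-- The matrix `Φᵀ D Φ`. -/
def Data.costMatrix (pb : Data d m p N n) (Φ : ClosedLoopMap d m p N) :
    Matrix (NoiseIdx d p N) (NoiseIdx d p N) ℝ :=
  Φᵀ * pb.D * Φ

/-- The worst-case expected cost `sup_{ℙ} 𝔼_{w ∼ ℙ}[wᵀ Φᵀ D Φ w]` over the ambiguity set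
(`-∞` if the ambiguity set is empty). -/
def Data.worstCase (pb : Data d m p N n) (Φ : ClosedLoopMap d m p N) : EReal :=
  ⨆ P ∈ pb.ball,
    ((∫⁻ w, ENNReal.ofReal (w.ofLp ⬝ᵥ (pb.costMatrix Φ *ᵥ w.ofLp)) ∂P : ℝ≥0∞) : EReal)

/-- The closed-loop maps admitted in the problem: the achievable ones with structure `𝒮`. -/
def Data.admissible (pb : Data d m p N n) (𝒮 : Set (ClosedLoopMap d m p N)) :
    Set (ClosedLoopMap d m p N) :=
  {Φ | Φ ∈ 𝒮 ∧ IsAchievable pb.A pb.B pb.E Φ}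

/-- The min-max problem is feasible: there are an admissible closed-loop map and a distribution in
the ambiguity set. -/
def Data.Feasible (pb : Data d m p N n) (𝒮 : Set (ClosedLoopMap d m p N)) : Prop :=
  (pb.admissible 𝒮).Nonempty ∧ pb.ball.Nonempty

/-- `Φ` solves the distributionally robust control problem. -/
def Data.IsOptimalMap (pb : Data d m p N n) (𝒮 : Set (ClosedLoopMap d m p N))
    (Φ : ClosedLoopMap d m p N) : Prop :=
  Φ ∈ pb.admissible 𝒮 ∧ IsMinOn pb.worstCase (pb.admissible 𝒮) Φ

/-- The optimal value `inf_Φ sup_ℙ 𝔼_{w ∼ ℙ}[wᵀ Φᵀ D Φ w]` over the admissible `Φ`. -/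
def Data.robustValue (pb : Data d m p N n) (𝒮 : Set (ClosedLoopMap d m p N)) : EReal :=
  ⨅ Φ ∈ pb.admissible 𝒮, pb.worstCase Φ

/-- The smallest radius in the feasibility condition. -/
def Data.minRadius (pb : Data d m p N n) : ℝ :=
  pb.ε / 2 * Real.log (pb.Sigma + (pb.ε / 2) • (1 : Matrix _ _ ℝ)).det
    - pb.ε * (d + (N - 1) * p : ℕ) / 2 * Real.log (pb.ε / 2)
    + pb.ε / 2 * (pb.mean.ofLp ⬝ᵥ (pb.Sigma⁻¹ *ᵥ pb.mean.ofLp))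
    + (1 / n) * ∑ i, ‖pb.w i‖ ^ 2
    - (1 / n) * ∑ i,
      ((pb.w i).ofLp + (pb.ε / 2) • (pb.Sigma⁻¹ *ᵥ pb.mean.ofLp)) ⬝ᵥ
        ((1 + (pb.ε / 2) • pb.Sigma⁻¹)⁻¹ *ᵥ
          ((pb.w i).ofLp + (pb.ε / 2) • (pb.Sigma⁻¹ *ᵥ pb.mean.ofLp)))

/-! ### The finite-dimensional program -/

/-- The decision variables `(lam, Q, (sᵢ), (ζᵢ), Φ)`. -/
@[ext]
structure Decision (d m p N n : ℕ) where
  /-- dual multiplier of the radius -/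
  lam : ℝ
  /-- upper bound of the cost matrix -/
  Q : Matrix (NoiseIdx d p N) (NoiseIdx d p N) ℝ
  /-- epigraph variables -/
  s : Fin n → ℝ
  /-- upper bounds of the quadratic terms -/
  ζ : Fin n → ℝ
  /-- closed-loop map -/
  Φ : ClosedLoopMap d m p N

/-- The objective `lam ρ + n⁻¹ ∑ᵢ sᵢ`. -/
def Data.objective (pb : Data d m p N n) (x : Decision d m p N n) : ℝ :=
  x.lam * pb.ρ + (1 / n) * ∑ i, x.s i

/-- `M = lam (I + (ε / 2) Σ⁻¹) - Q`. -/
def Data.M (pb : Data d m p N n) (x : Decision d m p N n) :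
    Matrix (NoiseIdx d p N) (NoiseIdx d p N) ℝ :=
  x.lam • (1 + (pb.ε / 2) • pb.Sigma⁻¹) - x.Q

/-- The log-determinant constraint for the `i`-th sample. -/
def Data.LogDet (pb : Data d m p N n) (x : Decision d m p N n) (i : Fin n) : Prop :=
  x.lam * pb.ε * (d + (N - 1) * p : ℕ) / 2 * Real.log (x.lam * pb.ε / 2)
    - x.lam * pb.ε / 2 * Real.log pb.Sigma.det
    - x.lam * pb.ε / 2 * Real.log (pb.M x).det
    + x.ζ i ≤ x.s i

/-- The linear matrix inequality for the `i`-th sample. -/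
def Data.SampleLMI (pb : Data d m p N n) (x : Decision d m p N n) (i : Fin n) : Prop :=
  let v : NoiseIdx d p N → ℝ :=
    x.lam • (pb.w i).ofLp + (x.lam * pb.ε / 2) • (pb.Sigma⁻¹ *ᵥ pb.mean.ofLp)
  (Matrix.fromBlocks (pb.M x) (Matrix.replicateCol Unit v) (Matrix.replicateRow Unit v)
    (Matrix.of fun _ _ : Unit => x.ζ i + x.lam * ‖pb.w i‖ ^ 2
      + x.lam * pb.ε / 2 * (pb.mean.ofLp ⬝ᵥ (pb.Sigma⁻¹ *ᵥ pb.mean.ofLp)))).PosSemidef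

/-- The linear matrix inequality `[Q, (D^{1/2} Φ)ᵀ; D^{1/2} Φ, I] ⪰ 0`. -/
def Data.CostLMI (pb : Data d m p N n) (x : Decision d m p N n) : Prop :=
  (Matrix.fromBlocks x.Q (CFC.sqrt pb.D * x.Φ)ᵀ (CFC.sqrt pb.D * x.Φ) 1).PosSemidef

/-- The feasible set of the program. -/
def Data.program (pb : Data d m p N n) (𝒮 : Set (ClosedLoopMap d m p N)) :
    Set (Decision d m p N n) :=
  {x | 0 ≤ x.lam ∧ x.Q.PosSemidef ∧ (pb.M x).PosDef ∧ (∀ i, pb.LogDet x i) ∧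
    (∀ i, pb.SampleLMI x i) ∧ pb.CostLMI x ∧ x.Φ ∈ pb.admissible 𝒮}

/-- The feasible set of the program with the additional constraint `Q = Φᵀ D Φ`. -/
def Data.exactProgram (pb : Data d m p N n) (𝒮 : Set (ClosedLoopMap d m p N)) :
    Set (Decision d m p N n) :=
  {x | x ∈ pb.program 𝒮 ∧ x.Q = pb.costMatrix x.Φ}

/-- `x` minimizes the objective over the feasible set `F`. -/
def Data.IsMinimizer (pb : Data d m p N n) (F : Set (Decision d m p N n))
    (x : Decision d m p N n) : Prop :=
  x ∈ F ∧ IsMinOn pb.objective F x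

/-- The infimum of the objective over the feasible set `F` (`+∞` if `F` is empty). -/
def Data.optValue (pb : Data d m p N n) (F : Set (Decision d m p N n)) : EReal :=
  ⨅ x ∈ F, (pb.objective x : EReal)

end SinkhornControl

end

/-! Fix an admissible `Φ`, put `K = Φᵀ D Φ`, and let `G(K)` be `ε` times the sample mean of the
log-partition functions of `(yᵀ K y - ‖x - y‖²) / ε` under the Gaussian reference. The
Donsker–Varadhan inequality, used with the first marginal prescribed, bounds the mean of `yᵀ K y` by
the transport cost of the coupling plus `G(K)`; the coupling tilted on each fiber attains equality.
When `I + (ε/2) Σ⁻¹ - K ≻ 0`, `G(K)` is a Gaussian integral with a closed form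
(`mul_logPartition_tiltExponent`). For `K = 0` this says that the least cost is `-G(0) = ρ_min`.

Replacing `K` by `K / λ` bounds the worst case by `λ (ρ + G(K / λ))`, which is the objective of the
program once `ζᵢ` and `sᵢ` are eliminated by Schur complements. This is weak duality
(`Data.worstCase_le_objective`).

For the converse put `θ = 1 / λ` and `g(θ) = G(θ K)`. The tilted measure at `θ` has mean cost
`g'(θ)` and Sinkhorn discrepancy at most `θ g'(θ) - g(θ)` (`exists_worstCase_measure`). If `θ > 0`
makes this expression equal to `ρ`, then `λ (ρ + g(θ)) = g'(θ)` and the gap closes with attainment;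
such `θ` exists when `ρ > ρ_min` and `K ≠ 0` (`exists_legendre_eq`). In the degenerate cases the
infimum is only approached: `λ → 0` if `K = 0`, and `λ → ∞` if `ρ = ρ_min`.

Lowering `Q` to `Φᵀ D Φ` enlarges `M`, which preserves every constraint and leaves the objective
alone, so the relaxation is exact. -/

namespace SinkhornControl

/-! ### Simultaneous diagonalization and Schur complements -/

section LinearAlgebra

variable {ι : Type*} [Fintype ι] [DecidableEq ι]

/-- `T` turns the pair `S`, `K` into the identity and the diagonal matrix `κ` by congruence. -/
structure SimDiag (S K T : Matrix ι ι ℝ) (κ : ι → ℝ) : Prop where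
  isUnit : IsUnit T
  one : Tᵀ * S * T = 1
  diag : Tᵀ * K * T = Matrix.diagonal κ

/-- Factor `S = Bᵀ B`, diagonalize the symmetric matrix `B⁻ᵀ K B⁻¹` by an orthogonal `U`, and take
`T = B⁻¹ U`. -/
theorem exists_simDiag {S K : Matrix ι ι ℝ} (hS : S.PosDef) (hK : K.IsHermitian) :
    ∃ T κ, SimDiag S K T κ := by
  obtain ⟨B, hB, hSB⟩ := CStarAlgebra.isStrictlyPositive_iff_eq_star_mul_self.mp
    (Matrix.isStrictlyPositive_iff_posDef.mpr hS)
  have hSB' : S = Bᵀ * B := by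
    rw [hSB, Matrix.star_eq_conjTranspose, Matrix.conjTranspose_eq_transpose_of_trivial]
  have hBd : IsUnit B.det := (Matrix.isUnit_iff_isUnit_det _).mp hB
  have hBBi : B * B⁻¹ = 1 := Matrix.mul_nonsing_inv _ hBd
  have hH : (B⁻¹ᵀ * K * B⁻¹).IsHermitian := by
    have := Matrix.isHermitian_conjTranspose_mul_mul B⁻¹ hK
    rwa [Matrix.conjTranspose_eq_transpose_of_trivial] at this
  set U : Matrix ι ι ℝ := (hH.eigenvectorUnitary : Matrix ι ι ℝ) with hU
  have hUU : Uᵀ * U = 1 := by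
    have := Unitary.coe_star_mul_self hH.eigenvectorUnitary
    rwa [Matrix.star_eq_conjTranspose, Matrix.conjTranspose_eq_transpose_of_trivial] at this
  obtain ⟨κ, hsp⟩ : ∃ κ, B⁻¹ᵀ * K * B⁻¹ = U * Matrix.diagonal κ * Uᵀ := by
    have := hH.spectral_theorem
    rw [Unitary.conjStarAlgAut_apply] at this
    rw [Matrix.star_eq_conjTranspose, Matrix.conjTranspose_eq_transpose_of_trivial] at this
    exact ⟨_, this⟩
  refine ⟨B⁻¹ * U, κ, ?_, ?_, ?_⟩
  · refine (Matrix.isUnit_nonsing_inv_iff.mpr hB).mul ?_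
    exact (Matrix.isUnit_iff_isUnit_det _).mpr (Matrix.isUnit_det_of_left_inverse hUU)
  · rw [hSB', Matrix.transpose_mul]
    calc Uᵀ * B⁻¹ᵀ * (Bᵀ * B) * (B⁻¹ * U) = Uᵀ * ((B * B⁻¹)ᵀ * (B * B⁻¹)) * U := by
          rw [Matrix.transpose_mul]; simp only [Matrix.mul_assoc]
      _ = 1 := by rw [hBBi]; simp [hUU]
  · rw [Matrix.transpose_mul]
    calc Uᵀ * B⁻¹ᵀ * K * (B⁻¹ * U) = Uᵀ * (B⁻¹ᵀ * K * B⁻¹) * U := by simp only [Matrix.mul_assoc]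
      _ = (Uᵀ * U) * Matrix.diagonal κ * (Uᵀ * U) := by
          rw [hsp]; simp only [Matrix.mul_assoc]
      _ = _ := by rw [hUU]; simp

namespace SimDiag

variable {S K T : Matrix ι ι ℝ} {κ : ι → ℝ}

theorem sub_smul (h : SimDiag S K T κ) (θ : ℝ) :
    Tᵀ * (S - θ • K) * T = Matrix.diagonal fun j => 1 - θ * κ j := by
  rw [Matrix.mul_sub, Matrix.sub_mul, h.one, Matrix.mul_smul, Matrix.smul_mul, h.diag]
  ext i j
  by_cases hij : i = j <;> simp [hij]

theorem eq_conj (h : SimDiag S K T κ) (θ : ℝ) :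
    S - θ • K = T⁻¹ᵀ * (Matrix.diagonal fun j => 1 - θ * κ j) * T⁻¹ := by
  have hT := (Matrix.isUnit_iff_isUnit_det _).mp h.isUnit
  have hTT : T * T⁻¹ = 1 := Matrix.mul_nonsing_inv _ hT
  rw [← h.sub_smul θ]
  calc S - θ • K = (T * T⁻¹)ᵀ * (S - θ • K) * (T * T⁻¹) := by rw [hTT]; simp
    _ = _ := by rw [Matrix.transpose_mul]; simp only [Matrix.mul_assoc]

theorem eq_conj_right (h : SimDiag S K T κ) :
    K = T⁻¹ᵀ * (Matrix.diagonal κ) * T⁻¹ := by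
  have hT := (Matrix.isUnit_iff_isUnit_det _).mp h.isUnit
  have hTT : T * T⁻¹ = 1 := Matrix.mul_nonsing_inv _ hT
  rw [← h.diag]
  calc K = (T * T⁻¹)ᵀ * K * (T * T⁻¹) := by rw [hTT]; simp
    _ = _ := by rw [Matrix.transpose_mul]; simp only [Matrix.mul_assoc]

theorem posDef_iff (h : SimDiag S K T κ) (θ : ℝ) :
    (S - θ • K).PosDef ↔ ∀ j, 0 < 1 - θ * κ j := by
  have hiff := Matrix.IsUnit.posDef_star_left_conjugate_iff (x := S - θ • K) h.isUnit
  rw [Matrix.star_eq_conjTranspose, Matrix.conjTranspose_eq_transpose_of_trivial,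
    h.sub_smul θ] at hiff
  rw [← hiff, Matrix.posDef_diagonal_iff]

theorem nonneg (h : SimDiag S K T κ) (hK : K.PosSemidef) (j : ι) : 0 ≤ κ j := by
  have hiff := Matrix.IsUnit.posSemidef_star_left_conjugate_iff (x := K) h.isUnit
  rw [Matrix.star_eq_conjTranspose, Matrix.conjTranspose_eq_transpose_of_trivial,
    h.diag, Matrix.posSemidef_diagonal_iff] at hiff
  exact hiff.mpr hK j

theorem ne_zero (h : SimDiag S K T κ) (hK : K ≠ 0) : ∃ j, κ j ≠ 0 := by
  by_contra! hc
  apply hK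
  rw [h.eq_conj_right, show κ = 0 from funext hc]
  simp

theorem det_sub_smul (h : SimDiag S K T κ) (θ : ℝ) :
    (S - θ • K).det = S.det * ∏ j, (1 - θ * κ j) := by
  have h1 := congrArg Matrix.det (h.sub_smul θ)
  have h2 := congrArg Matrix.det h.one
  rw [Matrix.det_mul, Matrix.det_mul, Matrix.det_transpose, Matrix.det_diagonal] at h1
  rw [Matrix.det_mul, Matrix.det_mul, Matrix.det_transpose, Matrix.det_one] at h2
  rw [← h1]
  linear_combination (-(S - θ • K).det) * h2

theorem dotProduct_inv (h : SimDiag S K T κ) {θ : ℝ} (hθ : ∀ j, 0 < 1 - θ * κ j) (b : ι → ℝ) :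
    b ⬝ᵥ ((S - θ • K)⁻¹ *ᵥ b) = ∑ j, (Tᵀ *ᵥ b) j ^ 2 / (1 - θ * κ j) := by
  have hT := (Matrix.isUnit_iff_isUnit_det _).mp h.isUnit
  have hTT : T⁻¹ * T = 1 := Matrix.nonsing_inv_mul _ hT
  have hTT' : T * T⁻¹ = 1 := Matrix.mul_nonsing_inv _ hT
  have hinv : (S - θ • K)⁻¹ = T * (Matrix.diagonal fun j => (1 - θ * κ j)⁻¹) * Tᵀ := by
    apply Matrix.inv_eq_right_inv
    rw [h.eq_conj θ]
    calc _ = T⁻¹ᵀ * ((Matrix.diagonal fun j => 1 - θ * κ j) * (T⁻¹ * T) *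
          (Matrix.diagonal fun j => (1 - θ * κ j)⁻¹)) * Tᵀ := by simp only [Matrix.mul_assoc]
      _ = (T * T⁻¹)ᵀ := by
          rw [hTT, Matrix.mul_one, Matrix.diagonal_mul_diagonal, Matrix.transpose_mul]
          have : (fun i => (1 - θ * κ i) * (1 - θ * κ i)⁻¹) = 1 := by
            ext i; simp [(hθ i).ne']
          rw [this]; simp
      _ = 1 := by rw [hTT']; simp
  rw [hinv, ← Matrix.mulVec_mulVec, ← Matrix.mulVec_mulVec, Matrix.dotProduct_mulVec,
    ← Matrix.mulVec_transpose]
  simp only [dotProduct, Matrix.mulVec_diagonal]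
  refine Finset.sum_congr rfl fun j _ => ?_
  ring

end SimDiag

/-- Diagonalizing `B - A` relative to `A` gives `det B = det A * ∏ (1 + κ j)` with all `κ j ≥ 0`. -/
theorem det_le_det_of_posSemidef_sub {A B : Matrix ι ι ℝ} (hA : A.PosDef)
    (hAB : (B - A).PosSemidef) : A.det ≤ B.det := by
  obtain ⟨T, κ, h⟩ := exists_simDiag hA hAB.isHermitian
  -- `θ = -1` turns the pencil `A - θ (B - A)` into `B`.
  have hd := h.det_sub_smul (-1)
  rw [neg_one_smul, sub_neg_eq_add, add_sub_cancel] at hd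
  rw [hd]
  refine le_mul_of_one_le_right hA.det_pos.le ?_
  refine Finset.one_le_prod fun j _ => ?_
  have := h.nonneg hAB j
  linarith

omit [Fintype ι] [DecidableEq ι] in
theorem posDef_of_posSemidef_sub {A B : Matrix ι ι ℝ} (hA : A.PosDef)
    (hAB : (B - A).PosSemidef) : B.PosDef := by
  simpa using hA.add_posSemidef hAB

/-- Schur complement criterion for a block matrix bordered by one row and column. -/
theorem posSemidef_fromBlocks_replicate_iff {M : Matrix ι ι ℝ} (hM : M.PosDef) (v : ι → ℝ)
    (c : ℝ) :
    (Matrix.fromBlocks M (Matrix.replicateCol Unit v) (Matrix.replicateRow Unit v)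
      (Matrix.of fun _ _ : Unit => c)).PosSemidef ↔ v ⬝ᵥ (M⁻¹ *ᵥ v) ≤ c := by
  let _ := hM.isUnit.invertible
  have := Matrix.PosDef.fromBlocks₁₁ (Matrix.replicateCol Unit v)
    (Matrix.of fun _ _ : Unit => c) hM
  rw [Matrix.conjTranspose_replicateCol, star_trivial] at this
  rw [this]
  have hd : ((Matrix.of fun _ _ : Unit => c) -
      Matrix.replicateRow Unit v * M⁻¹ * Matrix.replicateCol Unit v) =
      Matrix.diagonal fun _ : Unit => c - v ⬝ᵥ (M⁻¹ *ᵥ v) := by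
    ext i j
    simp [Matrix.mul_assoc, Matrix.mul_apply, dotProduct, Matrix.mulVec]
  rw [hd, Matrix.posSemidef_diagonal_iff]
  simp

omit [DecidableEq ι] in
theorem posSemidef_transpose_mul_mul_same {κ : Type*} [Fintype κ] {D : Matrix ι ι ℝ}
    (hD : D.PosSemidef) (Φ : Matrix ι κ ℝ) : (Φᵀ * D * Φ).PosSemidef := by
  have := hD.conjTranspose_mul_mul_same Φ
  rwa [Matrix.conjTranspose_eq_transpose_of_trivial] at this

/-- Schur complement of the identity block; `D^{1/2}` is symmetric and squares to `D`. -/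
theorem posSemidef_fromBlocks_sqrt_iff {κ : Type*} [Fintype κ] [DecidableEq κ]
    {D : Matrix ι ι ℝ} (hD : D.PosSemidef) (Q : Matrix κ κ ℝ) (Φ : Matrix ι κ ℝ) :
    (Matrix.fromBlocks Q (CFC.sqrt D * Φ)ᵀ (CFC.sqrt D * Φ) 1).PosSemidef ↔
      (Q - Φᵀ * D * Φ).PosSemidef := by
  have hs : (CFC.sqrt D)ᵀ = CFC.sqrt D := by
    have := (Matrix.nonneg_iff_posSemidef.mp (CFC.sqrt_nonneg D)).isHermitian
    rwa [Matrix.IsHermitian, Matrix.conjTranspose_eq_transpose_of_trivial] at this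
  have hm : CFC.sqrt D * CFC.sqrt D = D := CFC.sqrt_mul_sqrt_self D hD.nonneg
  let _ : Invertible (1 : Matrix ι ι ℝ) := invertibleOne
  have := Matrix.PosDef.fromBlocks₂₂ Q (CFC.sqrt D * Φ)ᵀ (Matrix.PosDef.one (n := ι) (R := ℝ))
  rw [Matrix.conjTranspose_eq_transpose_of_trivial, Matrix.transpose_transpose] at this
  rw [this, inv_one, Matrix.mul_one, Matrix.transpose_mul, hs]
  have : Φᵀ * CFC.sqrt D * (CFC.sqrt D * Φ) = Φᵀ * (CFC.sqrt D * CFC.sqrt D) * Φ := by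
    simp only [Matrix.mul_assoc]
  rw [this, hm]

end LinearAlgebra

end SinkhornControl

namespace SinkhornControl

/-! ### Gaussian integrals with a linear term -/

section GaussianIntegral

variable {ι : Type*} [Fintype ι] [DecidableEq ι]

omit [DecidableEq ι] in
theorem integral_exp_neg_norm_sq :
    ∫ y : EuclideanSpace ℝ ι, Real.exp (-‖y‖ ^ 2) = √(Real.pi ^ Fintype.card ι) := by
  have := GaussianFourier.integral_rexp_neg_mul_sq_norm (V := EuclideanSpace ℝ ι) one_pos
  simp only [neg_mul, one_mul, div_one, finrank_euclideanSpace] at this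
  rw [this, Real.sqrt_eq_rpow, ← Real.rpow_natCast, ← Real.rpow_mul Real.pi_pos.le]
  ring_nf

omit [DecidableEq ι] in
theorem integrable_exp_neg_norm_sq :
    Integrable fun y : EuclideanSpace ℝ ι => Real.exp (-‖y‖ ^ 2) := by
  refine .of_integral_ne_zero ?_
  rw [integral_exp_neg_norm_sq]
  have := Real.pi_pos
  positivity

/-- The Gaussian integral with a linear term, for the quadratic form of a positive definite
matrix. -/
theorem integral_exp_quadratic {A : Matrix ι ι ℝ} (hA : A.PosDef) (b : ι → ℝ) :
    (Integrable fun y : EuclideanSpace ℝ ι =>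
      Real.exp (-(y.ofLp ⬝ᵥ (A *ᵥ y.ofLp)) + 2 * (b ⬝ᵥ y.ofLp))) ∧
    ∫ y : EuclideanSpace ℝ ι, Real.exp (-(y.ofLp ⬝ᵥ (A *ᵥ y.ofLp)) + 2 * (b ⬝ᵥ y.ofLp)) =
      √(Real.pi ^ Fintype.card ι) / √A.det * Real.exp (b ⬝ᵥ (A⁻¹ *ᵥ b)) := by
  -- The second form is zero: only a `T` with `Tᵀ A T = 1` is wanted.
  obtain ⟨T, κ, h⟩ := exists_simDiag hA (Matrix.isHermitian_zero (n := ι) (α := ℝ))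
  have hT := (Matrix.isUnit_iff_isUnit_det _).mp h.isUnit
  have hdet : A.det * T.det ^ 2 = 1 := by
    have h2 := congrArg Matrix.det h.one
    rw [Matrix.det_mul, Matrix.det_mul, Matrix.det_transpose, Matrix.det_one] at h2
    linear_combination h2
  have hinv : b ⬝ᵥ (A⁻¹ *ᵥ b) = ∑ j, (Tᵀ *ᵥ b) j ^ 2 := by
    have := h.dotProduct_inv (θ := 0) (by simp) b
    simpa using this
  set f : EuclideanSpace ℝ ι →ₗ[ℝ] EuclideanSpace ℝ ι := Matrix.toEuclideanLin T with hf
  have hfdet : LinearMap.det f = T.det := LinearMap.det_toLpLin _ _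
  have hf0 : LinearMap.det f ≠ 0 := by rw [hfdet]; exact hT.ne_zero
  have hmap := Measure.map_linearMap_addHaar_eq_smul_addHaar
    (volume : Measure (EuclideanSpace ℝ ι)) hf0
  have hemb : MeasurableEmbedding f :=
    (LinearEquiv.ofIsUnitDet (f := f) (v := (EuclideanSpace.basisFun ι ℝ).toBasis)
      (v' := (EuclideanSpace.basisFun ι ℝ).toBasis) (by
        rw [LinearMap.det_toMatrix]; exact hf0.isUnit)).toContinuousLinearEquiv.toHomeomorph
      |>.measurableEmbedding
  -- After the substitution `y = T z` the exponent is `-‖z - c‖² + ‖c‖²`, and `|det T| = (det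
  -- A)^{-1/2}` is the Jacobian.
  set c : EuclideanSpace ℝ ι := WithLp.toLp 2 (Tᵀ *ᵥ b) with hc
  set g : EuclideanSpace ℝ ι → ℝ := fun y =>
    Real.exp (-(y.ofLp ⬝ᵥ (A *ᵥ y.ofLp)) + 2 * (b ⬝ᵥ y.ofLp)) with hg
  have hcn : ‖c‖ ^ 2 = b ⬝ᵥ (A⁻¹ *ᵥ b) := by
    rw [hinv, EuclideanSpace.real_norm_sq_eq]
  have hgf : ∀ z, g (f z) = Real.exp (-‖z - c‖ ^ 2) * Real.exp (b ⬝ᵥ (A⁻¹ *ᵥ b)) := by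
    intro z
    rw [← Real.exp_add, ← hcn]
    refine congrArg Real.exp ?_
    have h1 : (f z).ofLp = T *ᵥ z.ofLp := rfl
    have h2 : (T *ᵥ z.ofLp) ⬝ᵥ (A *ᵥ (T *ᵥ z.ofLp)) = ‖z‖ ^ 2 := by
      rw [EuclideanSpace.real_norm_sq_eq, dotProduct_comm, Matrix.dotProduct_mulVec,
        ← Matrix.mulVec_transpose, Matrix.mulVec_mulVec, Matrix.mulVec_mulVec,
        h.one, Matrix.one_mulVec]
      simp [dotProduct, sq]
    have h3 : b ⬝ᵥ (T *ᵥ z.ofLp) = inner ℝ z c := by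
      rw [Matrix.dotProduct_mulVec, ← Matrix.mulVec_transpose, EuclideanSpace.inner_eq_star_dotProduct]
      simp [hc]
    simp only [h1, h2, h3, norm_sub_sq_real]
    ring
  have hint : Integrable (fun z => g (f z)) := by
    simp only [hgf]
    exact (integrable_exp_neg_norm_sq.comp_sub_right c).mul_const _
  have hval : ∫ z, g (f z) = √(Real.pi ^ Fintype.card ι) * Real.exp (b ⬝ᵥ (A⁻¹ *ᵥ b)) := by
    simp only [hgf]
    rw [integral_mul_const, integral_sub_right_eq_self (fun z => Real.exp (-‖z‖ ^ 2)) c,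
      integral_exp_neg_norm_sq]
  have hc0 : ENNReal.ofReal |(LinearMap.det f)⁻¹| ≠ 0 := by simpa using hf0
  have hsq : |T.det| = (√A.det)⁻¹ := by
    rw [eq_comm, inv_eq_iff_eq_inv, Real.sqrt_eq_iff_mul_self_eq hA.det_pos.le (by positivity)]
    rw [← mul_inv, abs_mul_abs_self, ← sq]
    exact eq_inv_of_mul_eq_one_left hdet
  constructor
  · have := (hemb.integrable_map_iff (μ := volume) (g := g)).mpr hint
    rwa [hmap, integrable_smul_measure hc0 ENNReal.ofReal_ne_top] at this
  · have := hemb.integral_map (μ := volume) g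
    rw [hmap, integral_smul_measure, hval, hfdet, ENNReal.toReal_ofReal (abs_nonneg _),
      smul_eq_mul, abs_inv, hsq, inv_inv] at this
    have hpos : 0 < √A.det := Real.sqrt_pos.mpr hA.det_pos
    field_simp
    linarith

end GaussianIntegral

end SinkhornControl

namespace SinkhornControl

/-! ### Donsker–Varadhan with a prescribed first marginal -/

section FiberwiseTilting

variable {𝒳 𝒴 : Type*} [MeasurableSpace 𝒳] [MeasurableSpace 𝒴]

/-- The logarithmic partition function of `h` on the fiber over `x`. -/
noncomputable def logPartition (ν : Measure 𝒴) (h : 𝒳 × 𝒴 → ℝ) (x : 𝒳) : ℝ :=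
  Real.log (∫ y, Real.exp (h (x, y)) ∂ν)

/-- The function `h`, normalized on each fiber. -/
noncomputable def fiberNormalized (ν : Measure 𝒴) (h : 𝒳 × 𝒴 → ℝ) (z : 𝒳 × 𝒴) : ℝ :=
  h z - logPartition ν h z.1

/-- The exponential tilting of `P.prod ν` by `h`, normalized on each fiber. -/
noncomputable def fiberTilted (P : Measure 𝒳) (ν : Measure 𝒴) (h : 𝒳 × 𝒴 → ℝ) :
    Measure (𝒳 × 𝒴) :=
  (P.prod ν).tilted (fiberNormalized ν h)

variable {P : Measure 𝒳} {ν : Measure 𝒴} [IsProbabilityMeasure P] [IsProbabilityMeasure ν]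
  {h : 𝒳 × 𝒴 → ℝ}

theorem measurable_fiberNormalized (hm : Measurable h) : Measurable (fiberNormalized ν h) := by
  have hE : Measurable fun z : 𝒳 × 𝒴 => Real.exp (h z) := hm.exp
  have hL : Measurable (logPartition ν h) :=
    (hE.stronglyMeasurable.integral_prod_right').measurable.log
  exact hm.sub (hL.comp measurable_fst)

omit [MeasurableSpace 𝒳] [IsProbabilityMeasure ν] in
theorem integrable_exp_fiberNormalized_fiber
    (hi : ∀ x, Integrable (fun y => Real.exp (h (x, y))) ν) (x : 𝒳) :
    Integrable (fun y => Real.exp (fiberNormalized ν h (x, y))) ν := by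
  simp only [fiberNormalized, Real.exp_sub]
  exact (hi x).div_const _

omit [MeasurableSpace 𝒳] in
theorem integral_exp_fiberNormalized_fiber
    (hi : ∀ x, Integrable (fun y => Real.exp (h (x, y))) ν) (x : 𝒳) :
    ∫ y, Real.exp (fiberNormalized ν h (x, y)) ∂ν = 1 := by
  have hpos : 0 < ∫ y, Real.exp (h (x, y)) ∂ν := integral_exp_pos (hi x)
  simp only [fiberNormalized, Real.exp_sub, logPartition]
  rw [integral_div, Real.exp_log hpos, div_self hpos.ne']

theorem integrable_exp_fiberNormalized (hm : Measurable h)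
    (hi : ∀ x, Integrable (fun y => Real.exp (h (x, y))) ν) :
    Integrable (fun z => Real.exp (fiberNormalized ν h z)) (P.prod ν) := by
  rw [integrable_prod_iff (measurable_fiberNormalized hm).exp.aestronglyMeasurable]
  refine ⟨ae_of_all _ (integrable_exp_fiberNormalized_fiber hi), ?_⟩
  simp only [Real.norm_eq_abs, Real.abs_exp, integral_exp_fiberNormalized_fiber hi]
  exact integrable_const _

theorem integral_exp_fiberNormalized (hm : Measurable h)
    (hi : ∀ x, Integrable (fun y => Real.exp (h (x, y))) ν) :
    ∫ z, Real.exp (fiberNormalized ν h z) ∂(P.prod ν) = 1 := by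
  rw [integral_prod _ (integrable_exp_fiberNormalized hm hi)]
  simp [integral_exp_fiberNormalized_fiber hi]

theorem isProbabilityMeasure_fiberTilted (hm : Measurable h)
    (hi : ∀ x, Integrable (fun y => Real.exp (h (x, y))) ν) :
    IsProbabilityMeasure (fiberTilted P ν h) :=
  isProbabilityMeasure_tilted (integrable_exp_fiberNormalized hm hi)

/-- The density integrates to one on every fiber, so tilting moves no mass between fibers. -/
theorem map_fst_fiberTilted (hm : Measurable h)
    (hi : ∀ x, Integrable (fun y => Real.exp (h (x, y))) ν) :
    (fiberTilted P ν h).map Prod.fst = P := by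
  ext s hs
  have hf := measurable_fiberNormalized (ν := ν) hm
  rw [Measure.map_apply measurable_fst hs, fiberTilted, tilted_apply' _ _ (measurable_fst hs),
    integral_exp_fiberNormalized hm hi]
  simp only [div_one]
  rw [← lintegral_indicator (measurable_fst hs), lintegral_prod _
    ((hf.exp.ennreal_ofReal.indicator (measurable_fst hs)).aemeasurable)]
  have hfib : ∀ x, ∫⁻ y, (Prod.fst ⁻¹' s).indicator
      (fun z : 𝒳 × 𝒴 => ENNReal.ofReal (Real.exp (fiberNormalized ν h z))) (x, y) ∂ν =
      s.indicator 1 x := by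
    intro x
    by_cases hx : x ∈ s
    · have : ∀ y, (Prod.fst ⁻¹' s).indicator
          (fun z : 𝒳 × 𝒴 => ENNReal.ofReal (Real.exp (fiberNormalized ν h z))) (x, y) =
          ENNReal.ofReal (Real.exp (fiberNormalized ν h (x, y))) := fun y =>
        Set.indicator_of_mem (by exact hx) _
      simp only [this]
      rw [← ofReal_integral_eq_lintegral_ofReal (integrable_exp_fiberNormalized_fiber hi x)
        (ae_of_all _ fun _ => (Real.exp_pos _).le), integral_exp_fiberNormalized_fiber hi]
      simp [hx]
    · simp [hx]
  simp only [hfib]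
  rw [lintegral_indicator_one hs]

omit [IsProbabilityMeasure P] [IsProbabilityMeasure ν] in
theorem integral_logPartition_fst {γ : Measure (𝒳 × 𝒴)}
    (hγ : γ.map Prod.fst = P) (hL : Integrable (logPartition ν h) P) :
    Integrable (fun z => logPartition ν h z.1) γ ∧
      ∫ z, logPartition ν h z.1 ∂γ = ∫ x, logPartition ν h x ∂P := by
  subst hγ
  exact ⟨hL.comp_measurable measurable_fst,
    (integral_map measurable_fst.aemeasurable hL.aestronglyMeasurable).symm⟩

/-- The variational inequality of Donsker and Varadhan, with prescribed first marginal. -/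
theorem integral_le_toReal_klDiv_add {γ : Measure (𝒳 × 𝒴)} [IsProbabilityMeasure γ]
    (hm : Measurable h) (hi : ∀ x, Integrable (fun y => Real.exp (h (x, y))) ν)
    (hγ : γ.map Prod.fst = P) (hL : Integrable (logPartition ν h) P) (hh : Integrable h γ)
    (hkl : InformationTheory.klDiv γ (P.prod ν) ≠ ⊤) :
    ∫ z, h z ∂γ ≤ (InformationTheory.klDiv γ (P.prod ν)).toReal
      + ∫ x, logPartition ν h x ∂P := by
  obtain ⟨hac, hllr⟩ := InformationTheory.klDiv_ne_top_iff.mp hkl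
  obtain ⟨hL1, hL2⟩ := integral_logPartition_fst hγ hL
  have hE := integrable_exp_fiberNormalized (P := P) hm hi
  have hf : Integrable (fiberNormalized ν h) γ := hh.sub hL1
  have hprob := isProbabilityMeasure_fiberTilted (P := P) hm hi
  -- The inequality is nonnegativity of the divergence of `γ` from the tilted coupling; passing to
  -- that reference lowers the log-likelihood ratio by the normalized exponent.
  have h1 := integral_llr_tilted_right hac hf hE hllr
  have h2 := InformationTheory.integral_llr_add_sub_measure_univ_nonneg
    (hac.trans (absolutelyContinuous_tilted hE)) (integrable_llr_tilted_right hac hf hllr hE)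
  have h3 : ((P.prod ν).tilted (fiberNormalized ν h)).real Set.univ = 1 := by
    have : IsProbabilityMeasure ((P.prod ν).tilted (fiberNormalized ν h)) := hprob
    simp
  have h4 : ∫ z, fiberNormalized ν h z ∂γ = ∫ z, h z ∂γ - ∫ x, logPartition ν h x ∂P := by
    rw [← hL2, ← integral_sub hh hL1]; rfl
  rw [InformationTheory.toReal_klDiv_of_measure_eq hac (by simp)]
  rw [h1, h3, h4, integral_exp_fiberNormalized hm hi] at h2
  simp only [probReal_univ, Real.log_one] at h2
  linarith

/-- The log-likelihood ratio of the tilted coupling is the normalized exponent itself, which is the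
equality case of `integral_le_toReal_klDiv_add`. -/
theorem klDiv_fiberTilted
    (hm : Measurable h) (hi : ∀ x, Integrable (fun y => Real.exp (h (x, y))) ν)
    (hL : Integrable (logPartition ν h) P) (hh : Integrable h (fiberTilted P ν h)) :
    InformationTheory.klDiv (fiberTilted P ν h) (P.prod ν) ≠ ⊤ ∧
    (InformationTheory.klDiv (fiberTilted P ν h) (P.prod ν)).toReal =
      ∫ z, h z ∂(fiberTilted P ν h) - ∫ x, logPartition ν h x ∂P := by
  have hprob := isProbabilityMeasure_fiberTilted (P := P) hm hi
  obtain ⟨hL1, hL2⟩ := integral_logPartition_fst (map_fst_fiberTilted hm hi) hL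
  have hE := integrable_exp_fiberNormalized (P := P) hm hi
  have hac : fiberTilted P ν h ≪ P.prod ν := tilted_absolutelyContinuous _ _
  have hllr : llr (fiberTilted P ν h) (P.prod ν) =ᵐ[fiberTilted P ν h] fiberNormalized ν h := by
    refine hac.ae_le ?_
    filter_upwards [log_rnDeriv_tilted_left_self hE] with z hz
    rw [llr, fiberTilted, hz, integral_exp_fiberNormalized hm hi]
    simp
  have hf : Integrable (fiberNormalized ν h) (fiberTilted P ν h) := hh.sub hL1
  have hllri := (integrable_congr hllr).mpr hf
  refine ⟨InformationTheory.klDiv_ne_top hac hllri, ?_⟩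
  rw [InformationTheory.toReal_klDiv_of_measure_eq hac (by simp), integral_congr_ae hllr, ← hL2,
    ← integral_sub hh hL1]
  rfl

end FiberwiseTilting

end SinkhornControl

namespace SinkhornControl

/-! ### Integration against the empirical measure -/

section Empirical

variable {𝒵 : Type*} [MeasurableSpace 𝒵] {n : ℕ}

theorem isProbabilityMeasure_empirical (hn : 1 ≤ n) (w : Fin n → 𝒵) :
    IsProbabilityMeasure (empirical w) := by
  refine ⟨?_⟩
  have : (n : ℝ≥0∞) ≠ 0 := by exact_mod_cast (Nat.one_le_iff_ne_zero.mp hn)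
  simp [empirical, ENNReal.inv_mul_cancel this (ENNReal.natCast_ne_top n)]

theorem integrable_empirical [MeasurableSingletonClass 𝒵] (hn : 1 ≤ n) (w : Fin n → 𝒵)
    (F : 𝒵 → ℝ) : Integrable F (empirical w) := by
  have : (n : ℝ≥0∞) ≠ 0 := by exact_mod_cast (Nat.one_le_iff_ne_zero.mp hn)
  refine Integrable.smul_measure ?_ (ENNReal.inv_ne_top.mpr this)
  rw [integrable_finsetSum_measure]
  exact fun i _ => integrable_dirac (by simp)

theorem integral_empirical [MeasurableSingletonClass 𝒵] (w : Fin n → 𝒵)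
    (F : 𝒵 → ℝ) : ∫ x, F x ∂(empirical w) = (1 / n) * ∑ i, F (w i) := by
  rw [empirical, integral_smul_measure, integral_finsetSum_measure
    (fun i _ => integrable_dirac (by simp))]
  simp

end Empirical

/-! ### The Gaussian reference measure and its log-partition function -/

section GaussianReference

variable {ι : Type*} [Fintype ι]

/-- The quadratic form of a matrix. -/
noncomputable def quad (K : Matrix ι ι ℝ) (y : EuclideanSpace ℝ ι) : ℝ := y.ofLp ⬝ᵥ (K *ᵥ y.ofLp)

theorem continuous_quad (K : Matrix ι ι ℝ) : Continuous (quad K) := by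
  unfold quad
  fun_prop

theorem abs_quad_le (K : Matrix ι ι ℝ) : ∃ C, 0 ≤ C ∧ ∀ y, |quad K y| ≤ C * ‖y‖ ^ 2 := by
  classical
  refine ⟨‖LinearMap.toContinuousLinearMap (Matrix.toEuclideanLin K)‖, norm_nonneg _, fun y => ?_⟩
  have : quad K y = inner ℝ (LinearMap.toContinuousLinearMap (Matrix.toEuclideanLin K) y) y := by
    rw [EuclideanSpace.inner_eq_star_dotProduct]
    rfl
  rw [this, sq, ← mul_assoc]
  exact (abs_real_inner_le_norm _ _).trans
    (mul_le_mul_of_nonneg_right (ContinuousLinearMap.le_opNorm _ _) (norm_nonneg _))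

theorem integrable_quad {P : Measure (EuclideanSpace ℝ ι)} (K : Matrix ι ι ℝ)
    (h : Integrable (fun y => ‖y‖ ^ 2) P) : Integrable (quad K) P := by
  obtain ⟨C, hC, hK⟩ := abs_quad_le K
  refine (h.const_mul C).mono' (continuous_quad K).measurable.aestronglyMeasurable
    (ae_of_all _ hK)

variable [DecidableEq ι]

theorem quad_one (y : EuclideanSpace ℝ ι) : quad 1 y = ‖y‖ ^ 2 := by
  rw [quad, Matrix.one_mulVec, EuclideanSpace.real_norm_sq_eq]
  simp [dotProduct, sq]

/-- The density of the Gaussian measure. -/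
noncomputable def gaussianDensity (mean : EuclideanSpace ℝ ι) (Sigma : Matrix ι ι ℝ)
    (ξ : EuclideanSpace ℝ ι) : ℝ :=
  (√((2 * Real.pi) ^ Fintype.card ι * Sigma.det))⁻¹ *
      Real.exp (-(1 / 2) * ((ξ - mean).ofLp ⬝ᵥ (Sigma⁻¹ *ᵥ (ξ - mean).ofLp)))

variable {mean : EuclideanSpace ℝ ι} {Sigma : Matrix ι ι ℝ}

theorem gaussianDensity_nonneg (ξ : EuclideanSpace ℝ ι) : 0 ≤ gaussianDensity mean Sigma ξ := by
  unfold gaussianDensity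
  positivity

theorem continuous_gaussianDensity : Continuous (gaussianDensity mean Sigma) := by
  have := (continuous_quad Sigma⁻¹).comp (continuous_sub_right mean)
  exact continuous_const.mul ((continuous_const.mul this).rexp)

theorem integrable_gaussian_iff (g : EuclideanSpace ℝ ι → ℝ) :
    Integrable g (gaussian mean Sigma) ↔
      Integrable fun y => gaussianDensity mean Sigma y * g y := by
  have := integrable_withDensity_iff_integrable_smul₀' (μ := volume)
    (f := fun ξ => ENNReal.ofReal (gaussianDensity mean Sigma ξ)) (g := g)
    continuous_gaussianDensity.measurable.ennreal_ofReal.aemeasurable (by simp)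
  simp only [ENNReal.toReal_ofReal (gaussianDensity_nonneg _), smul_eq_mul] at this
  exact this

theorem integral_gaussian (g : EuclideanSpace ℝ ι → ℝ) :
    ∫ y, g y ∂(gaussian mean Sigma) = ∫ y, gaussianDensity mean Sigma y * g y := by
  have := integral_withDensity_eq_integral_toReal_smul (μ := volume)
    (f := fun ξ => ENNReal.ofReal (gaussianDensity mean Sigma ξ)) 
    continuous_gaussianDensity.measurable.ennreal_ofReal (by simp) g
  simp only [ENNReal.toReal_ofReal (gaussianDensity_nonneg _), smul_eq_mul] at this
  exact this

theorem isProbabilityMeasure_gaussian (hS : Sigma.PosDef) :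
    IsProbabilityMeasure (gaussian mean Sigma) := by
  have hA : ((1 / 2 : ℝ) • Sigma⁻¹).PosDef := hS.inv.smul (by norm_num)
  obtain ⟨h1, h2⟩ := integral_exp_quadratic hA 0
  have hden : ∀ y, gaussianDensity mean Sigma y =
      (√((2 * Real.pi) ^ Fintype.card ι * Sigma.det))⁻¹ *
        Real.exp (-((y - mean).ofLp ⬝ᵥ (((1 / 2 : ℝ) • Sigma⁻¹) *ᵥ (y - mean).ofLp))
          + 2 * ((0 : ι → ℝ) ⬝ᵥ (y - mean).ofLp)) := by
    intro y
    rw [gaussianDensity, Matrix.smul_mulVec, dotProduct_smul, smul_eq_mul, zero_dotProduct]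
    ring_nf
  have hi : Integrable (gaussianDensity mean Sigma) := by
    rw [show gaussianDensity mean Sigma = _ from funext hden]
    exact (h1.comp_sub_right mean).const_mul _
  have hv : ∫ y, gaussianDensity mean Sigma y = 1 := by
    simp only [hden]
    rw [integral_const_mul, integral_sub_right_eq_self (fun y : EuclideanSpace ℝ ι =>
      Real.exp (-(y.ofLp ⬝ᵥ (((1 / 2 : ℝ) • Sigma⁻¹) *ᵥ y.ofLp)) + 2 * ((0 : ι → ℝ) ⬝ᵥ y.ofLp))) mean,
      h2, Matrix.det_smul, Matrix.det_nonsing_inv, zero_dotProduct, Real.exp_zero, mul_one,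
      ← Real.sqrt_div' _ (by have := hS.det_pos; simp only [Ring.inverse_eq_inv']; positivity),
      ← Real.sqrt_inv, ← Real.sqrt_mul (by have := hS.det_pos; positivity), Real.sqrt_eq_one]
    have := hS.det_pos.ne'
    have := Real.pi_pos.ne'
    simp only [Ring.inverse_eq_inv']
    rw [mul_pow, div_pow, one_pow]
    field_simp
  refine ⟨?_⟩
  change (volume.withDensity fun ξ => ENNReal.ofReal (gaussianDensity mean Sigma ξ)) Set.univ = 1
  rw [withDensity_apply _ .univ, Measure.restrict_univ, ← ofReal_integral_eq_lintegral_ofReal hi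
    (ae_of_all _ gaussianDensity_nonneg), hv, ENNReal.ofReal_one]

/-- The exponent `(yᵀ K y - ‖x - y‖²) / ε` of the tilted couplings. -/
noncomputable def tiltExponent (ε : ℝ) (K : Matrix ι ι ℝ)
    (z : EuclideanSpace ℝ ι × EuclideanSpace ℝ ι) : ℝ :=
  (quad K z.2 - ‖z.1 - z.2‖ ^ 2) / ε

omit [DecidableEq ι] in
theorem measurable_tiltExponent (ε : ℝ) (K : Matrix ι ι ℝ) : Measurable (tiltExponent ε K) := by
  have := (continuous_quad K).measurable
  unfold tiltExponent
  fun_prop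

/-- The closed form of `ε log 𝔼_ν exp ((yᵀ K y - ‖x - y‖²) / ε)` for Gaussian `ν`. -/
noncomputable def freeEnergy (ε : ℝ) (mean : EuclideanSpace ℝ ι) (Sigma K : Matrix ι ι ℝ)
    (x : EuclideanSpace ℝ ι) : ℝ :=
  ε * Fintype.card ι / 2 * Real.log (ε / 2) - ε / 2 * Real.log Sigma.det
    - ε / 2 * Real.log (1 + (ε / 2) • Sigma⁻¹ - K).det
    + (x.ofLp + (ε / 2) • (Sigma⁻¹ *ᵥ mean.ofLp)) ⬝ᵥ ((1 + (ε / 2) • Sigma⁻¹ - K)⁻¹ *ᵥ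
      (x.ofLp + (ε / 2) • (Sigma⁻¹ *ᵥ mean.ofLp)))
    - ‖x‖ ^ 2 - ε / 2 * (mean.ofLp ⬝ᵥ (Sigma⁻¹ *ᵥ mean.ofLp))

variable {ε : ℝ} {K : Matrix ι ι ℝ}

/-- Collecting the terms in `y` brings the integrand to the form of `integral_exp_quadratic`; the
remaining factors depend only on `x` and the parameters. -/
theorem gaussianDensity_mul_exp_tiltExponent (hε : 0 < ε) (hS : Sigma.PosDef)
    (x y : EuclideanSpace ℝ ι) :
    gaussianDensity mean Sigma y * Real.exp (tiltExponent ε K (x, y)) =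
      (√((2 * Real.pi) ^ Fintype.card ι * Sigma.det))⁻¹ *
      Real.exp (-(‖x‖ ^ 2 + ε / 2 * (mean.ofLp ⬝ᵥ (Sigma⁻¹ *ᵥ mean.ofLp))) / ε) *
      Real.exp (-(y.ofLp ⬝ᵥ ((ε⁻¹ • (1 + (ε / 2) • Sigma⁻¹ - K)) *ᵥ y.ofLp)) +
        2 * ((ε⁻¹ • (x.ofLp + (ε / 2) • (Sigma⁻¹ *ᵥ mean.ofLp))) ⬝ᵥ y.ofLp)) := by
  rw [gaussianDensity, mul_assoc, mul_assoc, ← Real.exp_add, ← Real.exp_add]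
  congr 2
  have hsym : mean.ofLp ⬝ᵥ (Sigma⁻¹ *ᵥ y.ofLp) = y.ofLp ⬝ᵥ (Sigma⁻¹ *ᵥ mean.ofLp) := by
    have h := hS.inv.isHermitian
    rw [Matrix.IsHermitian, Matrix.conjTranspose_eq_transpose_of_trivial] at h
    rw [Matrix.dotProduct_mulVec, ← Matrix.mulVec_transpose, h, dotProduct_comm]
  have hn : ‖x - y‖ ^ 2 = ‖x‖ ^ 2 - 2 * (x.ofLp ⬝ᵥ y.ofLp) + y.ofLp ⬝ᵥ y.ofLp := by
    rw [norm_sub_sq_real, EuclideanSpace.inner_eq_star_dotProduct, ← quad_one y, quad,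
      Matrix.one_mulVec, star_trivial, dotProduct_comm]
  simp only [tiltExponent, quad, hn, WithLp.ofLp_sub, Matrix.mulVec_sub, sub_dotProduct,
    dotProduct_sub, Matrix.smul_mulVec, Matrix.sub_mulVec, Matrix.add_mulVec, Matrix.one_mulVec,
    dotProduct_smul, smul_dotProduct, add_dotProduct, dotProduct_add, smul_eq_mul, hsym]
  rw [dotProduct_comm (Sigma⁻¹ *ᵥ mean.ofLp) y.ofLp]
  field_simp
  ring

theorem integrable_exp_tiltExponent (hε : 0 < ε) (hS : Sigma.PosDef)
    (hK : (1 + (ε / 2) • Sigma⁻¹ - K).PosDef) (x : EuclideanSpace ℝ ι) :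
    Integrable (fun y => Real.exp (tiltExponent ε K (x, y))) (gaussian mean Sigma) := by
  rw [integrable_gaussian_iff]
  simp only [gaussianDensity_mul_exp_tiltExponent hε hS]
  exact (integral_exp_quadratic (hK.smul (inv_pos.mpr hε)) _).1.const_mul _

/-- In the logarithm of the Gaussian integral the powers of `π` cancel, and the powers of `2` and
`ε` combine into the `log (ε / 2)` term. -/
theorem mul_logPartition_tiltExponent (hε : 0 < ε) (hS : Sigma.PosDef)
    (hK : (1 + (ε / 2) • Sigma⁻¹ - K).PosDef) (x : EuclideanSpace ℝ ι) :
    ε * logPartition (gaussian mean Sigma) (tiltExponent ε K) x =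
      freeEnergy ε mean Sigma K x := by
  have hd := hS.det_pos
  have hk := hK.det_pos
  have hpi := Real.pi_pos
  have hinv : (ε⁻¹ • (1 + (ε / 2) • Sigma⁻¹ - K))⁻¹ = ε • (1 + (ε / 2) • Sigma⁻¹ - K)⁻¹ := by
    have := Matrix.inv_smul' (k := Units.mk0 ε⁻¹ (inv_pos.mpr hε).ne') (A := 1 + (ε / 2) • Sigma⁻¹ - K)
      hk.ne'.isUnit
    simpa [Units.smul_def] using this
  rw [logPartition, integral_gaussian]
  simp only [gaussianDensity_mul_exp_tiltExponent hε hS]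
  rw [integral_const_mul, (integral_exp_quadratic (hK.smul (inv_pos.mpr hε)) _).2, hinv,
    Matrix.det_smul]
  have e1 : 0 < (2 * Real.pi) ^ Fintype.card ι * Sigma.det := by positivity
  have e2 : 0 < ε⁻¹ ^ Fintype.card ι * (1 + (ε / 2) • Sigma⁻¹ - K).det := by positivity
  have e3 : 0 < Real.pi ^ Fintype.card ι := by positivity
  rw [Real.log_mul (by positivity) (by positivity), Real.log_mul (by positivity) (by positivity),
    Real.log_mul (by positivity) (by positivity), Real.log_inv, Real.log_sqrt e1.le,
    Real.log_exp, Real.log_exp, Real.log_div (by positivity) (by positivity), Real.log_sqrt e2.le,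
    Real.log_sqrt e3.le, Real.log_mul (by positivity) (by positivity),
    Real.log_mul (by positivity) (by positivity), Real.log_pow, Real.log_pow, Real.log_pow,
    Real.log_mul (by positivity) (by positivity), Real.log_inv, freeEnergy,
    Real.log_div (by positivity) (by positivity)]
  simp only [Matrix.smul_mulVec, Matrix.mulVec_smul, dotProduct_smul, smul_dotProduct, smul_eq_mul]
  field_simp
  ring

end GaussianReference

end SinkhornControl

namespace SinkhornControl

/-! ### Duality for the Sinkhorn discrepancy -/

section SinkhornDuality

variable {ι : Type*} [Fintype ι] [DecidableEq ι] {n : ℕ} {mean : EuclideanSpace ℝ ι}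
  {Sigma K : Matrix ι ι ℝ} {ε : ℝ} {w : Fin n → EuclideanSpace ℝ ι}

/-- The mean of the free energies over the samples. -/
noncomputable def meanFreeEnergy (ε : ℝ) (mean : EuclideanSpace ℝ ι) (Sigma : Matrix ι ι ℝ)
    (w : Fin n → EuclideanSpace ℝ ι) (K : Matrix ι ι ℝ) : ℝ :=
  (1 / n) * ∑ i, freeEnergy ε mean Sigma K (w i)

/-- The objective of the Sinkhorn discrepancy. -/
noncomputable def transportCost (ε : ℝ) (ν P : Measure (EuclideanSpace ℝ ι))
    (γ : Measure (EuclideanSpace ℝ ι × EuclideanSpace ℝ ι)) : ℝ≥0∞ :=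
  (∫⁻ z, ENNReal.ofReal (‖z.1 - z.2‖ ^ 2) ∂γ) +
      ENNReal.ofReal ε * InformationTheory.klDiv γ (P.prod ν)

theorem mul_integral_logPartition (hε : 0 < ε) (hS : Sigma.PosDef)
    (hK : (1 + (ε / 2) • Sigma⁻¹ - K).PosDef) :
    ε * ∫ x, logPartition (gaussian mean Sigma) (tiltExponent ε K) x ∂(empirical w) =
      meanFreeEnergy ε mean Sigma w K := by
  rw [integral_empirical, meanFreeEnergy, mul_left_comm, Finset.mul_sum]
  simp only [mul_logPartition_tiltExponent hε hS hK]

/-- Donsker–Varadhan for `tiltExponent`, multiplied by `ε`. Finite transport cost from finitely many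
samples forces a finite second moment on `P`, which supplies the integrability. -/
theorem integral_quad_le_of_transportCost_le (hn : 1 ≤ n) (hε : 0 < ε) (hS : Sigma.PosDef)
    (hK : (1 + (ε / 2) • Sigma⁻¹ - K).PosDef) {P : Measure (EuclideanSpace ℝ ι)}
    {γ : Measure (EuclideanSpace ℝ ι × EuclideanSpace ℝ ι)}
    (hγ : IsCoupling γ (empirical w) P) {r : ℝ} (hr : 0 ≤ r)
    (hJ : transportCost ε (gaussian mean Sigma) (empirical w) γ ≤ ENNReal.ofReal r) :
    Integrable (fun y => ‖y‖ ^ 2) P ∧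
      ∫ y, quad K y ∂P ≤ r + meanFreeEnergy ε mean Sigma w K := by
  have hemp := isProbabilityMeasure_empirical hn w
  have hν := isProbabilityMeasure_gaussian (mean := mean) hS
  have hγp : IsProbabilityMeasure γ := ⟨by
    rw [← Set.preimage_univ (f := Prod.fst), ← Measure.map_apply measurable_fst .univ, hγ.1]
    exact hemp.measure_univ⟩
  have htop : transportCost ε (gaussian mean Sigma) (empirical w) γ ≠ ⊤ :=
    ne_top_of_le_ne_top ENNReal.ofReal_ne_top hJ
  obtain ⟨h1, h2⟩ := ENNReal.add_ne_top.mp htop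
  have hkl : InformationTheory.klDiv γ ((empirical w).prod (gaussian mean Sigma)) ≠ ⊤ := by
    intro h
    rw [h, ENNReal.mul_top (by simpa using hε)] at h2
    exact h2 rfl
  have hc : Integrable (fun z : EuclideanSpace ℝ ι × EuclideanSpace ℝ ι => ‖z.1 - z.2‖ ^ 2) γ := by
    refine ⟨by fun_prop, ?_⟩
    rw [hasFiniteIntegral_iff_ofReal (ae_of_all _ fun _ => by positivity)]
    exact h1.lt_top
  have hx : Integrable (fun z : EuclideanSpace ℝ ι × EuclideanSpace ℝ ι => ‖z.1‖ ^ 2) γ := by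
    have : Integrable (fun x => ‖x‖ ^ 2) (γ.map Prod.fst) := by
      rw [hγ.1]; exact integrable_empirical hn w _
    exact this.comp_measurable measurable_fst
  have hy : Integrable (fun z : EuclideanSpace ℝ ι × EuclideanSpace ℝ ι => ‖z.2‖ ^ 2) γ := by
    refine ((hx.const_mul 2).add (hc.const_mul 2)).mono' (by fun_prop) (ae_of_all _ fun z => ?_)
    simp only [Pi.add_apply, norm_pow, norm_norm]
    have : ‖z.2‖ ≤ ‖z.1‖ + ‖z.1 - z.2‖ := by
      have := norm_sub_le z.1 (z.1 - z.2)
      rwa [sub_sub_cancel] at this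
    nlinarith [norm_nonneg z.2, sq_nonneg (‖z.1‖ - ‖z.1 - z.2‖), norm_nonneg z.1,
      norm_nonneg (z.1 - z.2)]
  have hyP : Integrable (fun y => ‖y‖ ^ 2) P := by
    rw [← hγ.2]
    exact (integrable_map_measure (by fun_prop) measurable_snd.aemeasurable).mpr hy
  refine ⟨hyP, ?_⟩
  have hqP := integrable_quad K hyP
  have hq : Integrable (fun z : EuclideanSpace ℝ ι × EuclideanSpace ℝ ι => quad K z.2) γ := by
    rw [← hγ.2] at hqP
    exact hqP.comp_measurable measurable_snd
  have hqeq : ∫ y, quad K y ∂P = ∫ z, quad K z.2 ∂γ := by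
    rw [← hγ.2]
    exact integral_map measurable_snd.aemeasurable
      (continuous_quad K).measurable.aestronglyMeasurable
  have hDV := integral_le_toReal_klDiv_add (measurable_tiltExponent ε K)
    (integrable_exp_tiltExponent (mean := mean) hε hS hK) hγ.1
    (integrable_empirical hn w _) ((hq.sub hc).div_const ε) hkl
  have hint : ∫ z, tiltExponent ε K z ∂γ =
      (∫ z, quad K z.2 ∂γ - ∫ z, ‖z.1 - z.2‖ ^ 2 ∂γ) / ε := by
    unfold tiltExponent
    rw [integral_div, integral_sub hq hc]
  rw [hint, div_le_iff₀ hε, add_mul, mul_comm _ ε, mul_comm _ ε,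
    mul_integral_logPartition hε hS hK] at hDV
  have hJr : ∫ z, ‖z.1 - z.2‖ ^ 2 ∂γ +
      ε * (InformationTheory.klDiv γ ((empirical w).prod (gaussian mean Sigma))).toReal ≤ r := by
    have := ENNReal.toReal_mono ENNReal.ofReal_ne_top hJ
    rw [ENNReal.toReal_ofReal hr, transportCost, ENNReal.toReal_add h1 h2, ENNReal.toReal_mul,
      ENNReal.toReal_ofReal hε.le, ← integral_eq_lintegral_of_nonneg_ae
      (ae_of_all _ fun _ => by positivity) hc.1] at this
    exact this
  rw [hqeq]
  linarith

-- The infimum over couplings is not known to be attained; the slack `δ` is sent to zero later.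
omit [DecidableEq ι] in
theorem exists_coupling_of_mem_ambiguitySet {P Q ν : Measure (EuclideanSpace ℝ ι)} {ρ δ : ℝ}
    (hQ : Q ∈ ambiguitySet ρ ε ν P) (hρ : 0 ≤ ρ) (hδ : 0 < δ) :
    ∃ γ, IsCoupling γ P Q ∧ transportCost ε ν P γ ≤ ENNReal.ofReal (ρ + δ) := by
  have hlt : sinkhorn ε ν P Q < ENNReal.ofReal (ρ + δ) :=
    hQ.2.trans_lt ((ENNReal.ofReal_lt_ofReal_iff (by linarith)).mpr (by linarith))
  rw [sinkhorn, iInf_lt_iff] at hlt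
  obtain ⟨γ, hγ⟩ := hlt
  rw [iInf_lt_iff] at hγ
  obtain ⟨hc, hγ⟩ := hγ
  exact ⟨γ, hc, hγ.le⟩

/-- Weak duality. -/
theorem integral_quad_le_of_mem_ambiguitySet (hn : 1 ≤ n) (hε : 0 < ε) (hS : Sigma.PosDef)
    (hK : (1 + (ε / 2) • Sigma⁻¹ - K).PosDef) {P : Measure (EuclideanSpace ℝ ι)} {ρ : ℝ}
    (hρ : 0 ≤ ρ) (hP : P ∈ ambiguitySet ρ ε (gaussian mean Sigma) (empirical w)) :
    Integrable (fun y => ‖y‖ ^ 2) P ∧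
      ∫ y, quad K y ∂P ≤ ρ + meanFreeEnergy ε mean Sigma w K := by
  constructor
  · obtain ⟨γ, hγ, hJ⟩ := exists_coupling_of_mem_ambiguitySet hP hρ one_pos
    exact (integral_quad_le_of_transportCost_le hn hε hS hK hγ (by linarith) hJ).1
  · refine le_of_forall_pos_le_add fun δ hδ => ?_
    obtain ⟨γ, hγ, hJ⟩ := exists_coupling_of_mem_ambiguitySet hP hρ hδ
    have := (integral_quad_le_of_transportCost_le hn hε hS hK hγ (by linarith) hJ).2
    linarith

/-- Positive definiteness is an open condition. The margin `η` pays for a factor `‖y‖²` in the next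
lemma. -/
theorem exists_pos_posDef_sub_smul_one {A : Matrix ι ι ℝ} (hA : A.PosDef) :
    ∃ η : ℝ, 0 < η ∧ (A - η • (1 : Matrix ι ι ℝ)).PosDef := by
  obtain ⟨T, κ, h⟩ := exists_simDiag hA (Matrix.isHermitian_one (n := ι) (α := ℝ))
  have hev : ∀ᶠ η : ℝ in nhdsWithin 0 (Set.Ioi 0), ∀ j, 0 < 1 - η * κ j := by
    rw [Filter.eventually_all]
    intro j
    have hc : ContinuousAt (fun η : ℝ => 1 - η * κ j) 0 := by fun_prop
    exact (hc.eventually_const_lt (by simp)).filter_mono nhdsWithin_le_nhds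
  obtain ⟨η, h1, h2⟩ := (hev.and self_mem_nhdsWithin).exists
  exact ⟨η, h2, (h.posDef_iff η).mpr h1⟩

/-- Since `‖y‖² ≤ (ε / η) exp (η ‖y‖² / ε)`, the polynomial factor is absorbed by tilting with `K +
η I` instead of `K`. -/
theorem integrable_norm_sq_mul_exp_tiltExponent (hε : 0 < ε) (hS : Sigma.PosDef)
    (hK : (1 + (ε / 2) • Sigma⁻¹ - K).PosDef) (x : EuclideanSpace ℝ ι) :
    Integrable (fun y => ‖y‖ ^ 2 * Real.exp (tiltExponent ε K (x, y))) (gaussian mean Sigma) := by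
  obtain ⟨η, hη, hA⟩ := exists_pos_posDef_sub_smul_one hK
  rw [sub_sub] at hA
  refine ((integrable_exp_tiltExponent hε hS hA x).const_mul (ε / η)).mono' ?_
    (ae_of_all _ fun y => ?_)
  · have := (measurable_tiltExponent ε K).comp (measurable_prodMk_left (x := x))
    exact (Measurable.mul (by fun_prop) this.exp).aestronglyMeasurable
  · have hq : tiltExponent ε (K + η • 1) (x, y) = η / ε * ‖y‖ ^ 2 + tiltExponent ε K (x, y) := by
      have : quad (K + η • 1) y = quad K y + η * ‖y‖ ^ 2 := by
        rw [← quad_one y]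
        simp only [quad, Matrix.add_mulVec, Matrix.smul_mulVec, dotProduct_add, dotProduct_smul,
          smul_eq_mul]
      simp only [tiltExponent, this]
      ring
    rw [hq, Real.exp_add, ← mul_assoc, Real.norm_of_nonneg (by positivity)]
    refine mul_le_mul_of_nonneg_right ?_ (Real.exp_pos _).le
    have h1 : η / ε * ‖y‖ ^ 2 ≤ Real.exp (η / ε * ‖y‖ ^ 2) := by
      linarith [Real.add_one_le_exp (η / ε * ‖y‖ ^ 2)]
    calc ‖y‖ ^ 2 = ε / η * (η / ε * ‖y‖ ^ 2) := by field_simp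
      _ ≤ _ := mul_le_mul_of_nonneg_left h1 (by positivity)

/-- The fiberwise tilted coupling attains equality in the duality inequality. -/
theorem exists_measure_sinkhorn_le (hn : 1 ≤ n) (hε : 0 < ε) (hS : Sigma.PosDef)
    (hK : (1 + (ε / 2) • Sigma⁻¹ - K).PosDef) (w : Fin n → EuclideanSpace ℝ ι) :
    ∃ P : Measure (EuclideanSpace ℝ ι), IsProbabilityMeasure P ∧
      Integrable (fun y => ‖y‖ ^ 2) P ∧
      0 ≤ ∫ y, quad K y ∂P - meanFreeEnergy ε mean Sigma w K ∧
      sinkhorn ε (gaussian mean Sigma) (empirical w) P ≤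
        ENNReal.ofReal (∫ y, quad K y ∂P - meanFreeEnergy ε mean Sigma w K) := by
  have hemp := isProbabilityMeasure_empirical hn w
  have hν := isProbabilityMeasure_gaussian (mean := mean) hS
  have hm := measurable_tiltExponent ε K
  have hi := integrable_exp_tiltExponent (mean := mean) hε hS hK
  set γ := fiberTilted (empirical w) (gaussian mean Sigma) (tiltExponent ε K) with hγ
  have hγp : IsProbabilityMeasure γ := isProbabilityMeasure_fiberTilted hm hi
  have hfst : γ.map Prod.fst = empirical w := map_fst_fiberTilted hm hi
  have hy : Integrable (fun z : EuclideanSpace ℝ ι × EuclideanSpace ℝ ι => ‖z.2‖ ^ 2) γ := by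
    rw [hγ, fiberTilted, integrable_tilted_iff (integrable_exp_fiberNormalized hm hi)]
    have hmeas : Measurable fun z : EuclideanSpace ℝ ι × EuclideanSpace ℝ ι =>
        Real.exp (fiberNormalized (gaussian mean Sigma) (tiltExponent ε K) z) • ‖z.2‖ ^ 2 :=
      (measurable_fiberNormalized hm).exp.smul (by fun_prop)
    rw [integrable_prod_iff hmeas.aestronglyMeasurable]
    refine ⟨ae_of_all _ fun x => ?_, integrable_empirical hn w _⟩
    simp only [fiberNormalized, Real.exp_sub, smul_eq_mul]
    refine ((integrable_norm_sq_mul_exp_tiltExponent (mean := mean) hε hS hK x).div_const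
      (Real.exp (logPartition (gaussian mean Sigma) (tiltExponent ε K) x))).congr
      (ae_of_all _ fun y => ?_)
    ring
  have hx : Integrable (fun z : EuclideanSpace ℝ ι × EuclideanSpace ℝ ι => ‖z.1‖ ^ 2) γ := by
    have : Integrable (fun x => ‖x‖ ^ 2) (γ.map Prod.fst) := by
      rw [hfst]; exact integrable_empirical hn w _
    exact this.comp_measurable measurable_fst
  have hc : Integrable (fun z : EuclideanSpace ℝ ι × EuclideanSpace ℝ ι => ‖z.1 - z.2‖ ^ 2) γ := by
    refine ((hx.const_mul 2).add (hy.const_mul 2)).mono' (by fun_prop) (ae_of_all _ fun z => ?_)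
    simp only [Pi.add_apply, norm_pow, norm_norm]
    have := norm_sub_le z.1 z.2
    nlinarith [norm_nonneg z.2, sq_nonneg (‖z.1‖ - ‖z.2‖), norm_nonneg z.1,
      norm_nonneg (z.1 - z.2)]
  set P := γ.map Prod.snd with hP
  have hyP : Integrable (fun y => ‖y‖ ^ 2) P :=
    (integrable_map_measure (by fun_prop) measurable_snd.aemeasurable).mpr hy
  have hq : Integrable (fun z : EuclideanSpace ℝ ι × EuclideanSpace ℝ ι => quad K z.2) γ :=
    (integrable_quad K hyP).comp_measurable measurable_snd
  have hqeq : ∫ y, quad K y ∂P = ∫ z, quad K z.2 ∂γ :=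
    integral_map measurable_snd.aemeasurable (continuous_quad K).measurable.aestronglyMeasurable
  obtain ⟨hkl, hkl'⟩ := klDiv_fiberTilted (P := empirical w) hm hi (integrable_empirical hn w _)
    ((hq.sub hc).div_const ε)
  rw [← hγ] at hkl hkl'
  have hint : ∫ z, tiltExponent ε K z ∂γ =
      (∫ z, quad K z.2 ∂γ - ∫ z, ‖z.1 - z.2‖ ^ 2 ∂γ) / ε := by
    unfold tiltExponent
    rw [integral_div, integral_sub hq hc]
  -- The divergence contains the transport cost with a minus sign, so it cancels and leaves the dual
  -- expression.
  have hsum : ∫ z, ‖z.1 - z.2‖ ^ 2 ∂γ +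
      ε * (InformationTheory.klDiv γ ((empirical w).prod (gaussian mean Sigma))).toReal =
      ∫ y, quad K y ∂P - meanFreeEnergy ε mean Sigma w K := by
    rw [hkl', hint, mul_sub, mul_integral_logPartition hε hS hK, mul_div_cancel₀ _ hε.ne', hqeq]
    ring
  have hpos : 0 ≤ ∫ z, ‖z.1 - z.2‖ ^ 2 ∂γ := integral_nonneg fun _ => by positivity
  have hcost : transportCost ε (gaussian mean Sigma) (empirical w) γ =
      ENNReal.ofReal (∫ y, quad K y ∂P - meanFreeEnergy ε mean Sigma w K) := by
    rw [← hsum, ENNReal.ofReal_add hpos (by positivity), ENNReal.ofReal_mul hε.le,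
      ENNReal.ofReal_toReal hkl, ofReal_integral_eq_lintegral_ofReal hc
      (ae_of_all _ fun _ => by positivity)]
    rfl
  refine ⟨P, Measure.isProbabilityMeasure_map measurable_snd.aemeasurable, hyP, ?_, ?_⟩
  · rw [← hsum]
    positivity
  · rw [← hcost]
    exact iInf₂_le γ ⟨hfst, rfl⟩

end SinkhornDuality

end SinkhornControl

namespace SinkhornControl

/-! ### The Legendre equation in one variable -/

section Profile

variable {ι : Type*} [Fintype ι] {ε C : ℝ} {α κ : ι → ℝ}

/-- The mean free energy of `θ • K` in coordinates that diagonalize `K`. -/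
noncomputable def energyProfile (ε C : ℝ) (α κ : ι → ℝ) (θ : ℝ) : ℝ :=
  C + ∑ j, (α j / (1 - θ * κ j) - ε / 2 * Real.log (1 - θ * κ j))

/-- The derivative of `energyProfile`. -/
noncomputable def energySlope (ε : ℝ) (α κ : ι → ℝ) (θ : ℝ) : ℝ :=
  ∑ j, (α j * κ j / (1 - θ * κ j) ^ 2 + ε / 2 * (κ j / (1 - θ * κ j)))

theorem hasDerivAt_energyProfile {θ : ℝ} (hθ : ∀ j, 0 < 1 - θ * κ j) :
    HasDerivAt (energyProfile ε C α κ) (energySlope ε α κ θ) θ := by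
  unfold energyProfile energySlope
  refine (HasDerivAt.fun_sum fun j _ => ?_).const_add C
  have h1 : HasDerivAt (fun θ : ℝ => 1 - θ * κ j) (-κ j) θ := by
    simpa using ((hasDerivAt_id θ).mul_const (κ j)).const_sub 1
  have h2 := (((hasDerivAt_const θ (α j)).fun_div h1 (hθ j).ne').fun_sub
    ((h1.log (hθ j).ne').const_mul (ε / 2)))
  refine h2.congr_deriv ?_
  have := (hθ j).ne'
  field_simp
  ring

theorem continuousOn_energySlope {s : Set ℝ} (hs : ∀ θ ∈ s, ∀ j, 0 < 1 - θ * κ j) :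
    ContinuousOn (energySlope ε α κ) s := by
  unfold energySlope
  refine continuousOn_finsetSum _ fun j _ => ?_
  have h1 : ContinuousOn (fun θ : ℝ => 1 - θ * κ j) s := by fun_prop
  have h0 : ∀ θ ∈ s, 1 - θ * κ j ≠ 0 := fun θ hθ => (hs θ hθ j).ne'
  exact (continuousOn_const.div (h1.pow 2) fun θ hθ => pow_ne_zero 2 (h0 θ hθ)).add
    (continuousOn_const.mul (continuousOn_const.div h1 h0))

/-- The difference of the two sides is `a t² / (1 - t)²`. -/
theorem neg_le_legendre_term {a t : ℝ} (ha : 0 ≤ a) (ht : t < 1) :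
    -a ≤ a * t / (1 - t) ^ 2 - a / (1 - t) := by
  have h : 0 < 1 - t := by linarith
  have : a * t / (1 - t) ^ 2 - a / (1 - t) + a = a * t ^ 2 / (1 - t) ^ 2 := by
    field_simp
    ring
  have : 0 ≤ a * t ^ 2 / (1 - t) ^ 2 := by positivity
  linarith

theorem legendre_log_term_nonneg {t : ℝ} (ht : t < 1) :
    0 ≤ t / (1 - t) + Real.log (1 - t) := by
  have h : 0 < 1 - t := by linarith
  have h1 := Real.one_sub_inv_le_log_of_pos h
  have : t / (1 - t) = (1 - t)⁻¹ - 1 := by field_simp; ring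
  linarith

/-- With `r = (1 - t)⁻¹` the right side is `r - 1 - log r`, and `log r ≤ r / 2` follows from `log (r
/ 2) ≤ r / 2 - 1` and `log 2 ≤ 1`. This growth makes the Legendre expression unbounded as `t → 1`.
-/
theorem half_inv_sub_one_le_legendre_log_term {t : ℝ} (ht : t < 1) :
    (1 - t)⁻¹ / 2 - 1 ≤ t / (1 - t) + Real.log (1 - t) := by
  have h : 0 < 1 - t := by linarith
  have h1 := Real.add_one_le_exp (Real.log ((1 - t)⁻¹ / 2))
  rw [Real.exp_log (by positivity), Real.log_div (by positivity) (by norm_num), Real.log_inv] at h1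
  have h2 : Real.log 2 ≤ 1 := by
    have := Real.log_le_sub_one_of_pos (show (0 : ℝ) < 2 by norm_num)
    linarith
  have : t / (1 - t) = (1 - t)⁻¹ - 1 := by field_simp; ring
  linarith

theorem mul_energySlope_sub_energyProfile (θ : ℝ) :
    θ * energySlope ε α κ θ - energyProfile ε C α κ θ =
      -C + ∑ j, ((α j * (θ * κ j) / (1 - θ * κ j) ^ 2 - α j / (1 - θ * κ j)) +
        ε / 2 * (θ * κ j / (1 - θ * κ j) + Real.log (1 - θ * κ j))) := by
  have : ∀ a b c d : ℝ, a - (c + b) = -c + d ↔ a - b = d := fun a b c d => by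
    constructor <;> intro h <;> linarith
  rw [energyProfile, energySlope, this, Finset.mul_sum, ← Finset.sum_sub_distrib]
  exact Finset.sum_congr rfl fun j _ => by ring

/-- Intermediate value theorem: the expression is below `ρ` at `θ = 0` and blows up as `θ`
approaches the reciprocal of the largest `κ j`. -/
theorem exists_legendre_eq (hε : 0 < ε) (hα : ∀ j, 0 ≤ α j) (hκ : ∀ j, 0 ≤ κ j)
    (hκ0 : ∃ j, κ j ≠ 0) {ρ : ℝ} (hρ : -energyProfile ε C α κ 0 < ρ) :
    ∃ θ, 0 < θ ∧ (∀ j, 0 < 1 - θ * κ j) ∧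
      θ * energySlope ε α κ θ - energyProfile ε C α κ θ = ρ := by
  obtain ⟨j₀, hj₀⟩ := hκ0
  have : Nonempty ι := ⟨j₀⟩
  obtain ⟨k, hk⟩ := Finite.exists_max κ
  have hkpos : 0 < κ k := ((hκ j₀).lt_of_ne' hj₀).trans_le (hk j₀)
  -- `u` is the value of `1 / (1 - θ₁ κ k)`; it is large enough that `-C - ∑ α j + (ε / 2) (u / 2 -
  -- 1) ≥ ρ`, and `u ≥ 1` gives `θ₁ ≥ 0`.
  set u : ℝ := max 1 (2 * (1 + 2 / ε * (ρ + C + ∑ j, α j))) with hu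
  have hu1 : 1 ≤ u := le_max_left _ _
  have hu2 : 2 * (1 + 2 / ε * (ρ + C + ∑ j, α j)) ≤ u := le_max_right _ _
  have hu0 : 0 < u := by linarith
  have hui : u⁻¹ ≤ 1 := inv_le_one_of_one_le₀ hu1
  set θ₁ : ℝ := (1 - u⁻¹) / κ k with hθ₁
  have hθ₁0 : 0 ≤ θ₁ := div_nonneg (by linarith) hkpos.le
  have hθ₁k : θ₁ * κ k = 1 - u⁻¹ := div_mul_cancel₀ _ hkpos.ne'
  have hdom : ∀ θ ∈ Set.Icc 0 θ₁, ∀ j, 0 < 1 - θ * κ j := by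
    intro θ hθ j
    have h1 : θ * κ j ≤ θ₁ * κ k := mul_le_mul hθ.2 (hk j) (hκ j) hθ₁0
    have h2 : 0 < u⁻¹ := inv_pos.mpr hu0
    linarith
  have hcont : ContinuousOn
      (fun θ => θ * energySlope ε α κ θ - energyProfile ε C α κ θ) (Set.Icc 0 θ₁) :=
    (continuousOn_id.mul (continuousOn_energySlope hdom)).sub fun θ hθ =>
      (hasDerivAt_energyProfile (hdom θ hθ)).continuousAt.continuousWithinAt
  have hlow : ρ ≤ θ₁ * energySlope ε α κ θ₁ - energyProfile ε C α κ θ₁ := by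
    have hlt : ∀ j, θ₁ * κ j < 1 := fun j => by
      have := hdom θ₁ ⟨hθ₁0, le_rfl⟩ j
      linarith
    rw [mul_energySlope_sub_energyProfile, Finset.sum_add_distrib]
    have h1 : -∑ j, α j ≤ ∑ j, (α j * (θ₁ * κ j) / (1 - θ₁ * κ j) ^ 2 - α j / (1 - θ₁ * κ j)) := by
      rw [← Finset.sum_neg_distrib]
      exact Finset.sum_le_sum fun j _ => neg_le_legendre_term (hα j) (hlt j)
    have h2 : ε / 2 * (u / 2 - 1) ≤
        ∑ j, ε / 2 * (θ₁ * κ j / (1 - θ₁ * κ j) + Real.log (1 - θ₁ * κ j)) := by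
      refine le_trans ?_ (Finset.single_le_sum (f := fun j =>
        ε / 2 * (θ₁ * κ j / (1 - θ₁ * κ j) + Real.log (1 - θ₁ * κ j)))
        (fun j _ => mul_nonneg (by positivity) (legendre_log_term_nonneg (hlt j)))
        (Finset.mem_univ k))
      refine mul_le_mul_of_nonneg_left ?_ (by positivity)
      have := half_inv_sub_one_le_legendre_log_term (hlt k)
      rwa [show (1 - θ₁ * κ k)⁻¹ = u by rw [hθ₁k, sub_sub_cancel, inv_inv]] at this
    have h3 : ρ + C + ∑ j, α j ≤ ε / 2 * (u / 2 - 1) := by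
      calc ρ + C + ∑ j, α j = ε / 2 * (2 / ε * (ρ + C + ∑ j, α j)) := by field_simp
        _ ≤ _ := mul_le_mul_of_nonneg_left (by linarith) (by positivity)
    linarith
  obtain ⟨θ, hθ, hθρ⟩ := intermediate_value_Icc hθ₁0 hcont
    (show ρ ∈ Set.Icc _ _ from ⟨by simpa using hρ.le, hlow⟩)
  -- `θ = 0` is excluded because the bound on `ρ` is strict.
  refine ⟨θ, hθ.1.lt_of_ne ?_, hdom θ hθ, hθρ⟩
  rintro rfl
  simp only [zero_mul, zero_sub] at hθρ
  linarith

end Profile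

/-! ### Worst-case measures -/

section WorstCaseMeasure

variable {ι : Type*} [Fintype ι] [DecidableEq ι] {n : ℕ} {mean : EuclideanSpace ℝ ι}
  {Sigma K T : Matrix ι ι ℝ} {ε : ℝ} {w : Fin n → EuclideanSpace ℝ ι} {κ : ι → ℝ}

/-- In the coordinates of `T` the inverse and the log-determinant split over `j`. Each `α j` is a
sample mean of squared coordinates, and `C` gathers what does not depend on `θ`. -/
theorem exists_meanFreeEnergy_eq (hn : 1 ≤ n) (hS : (1 + (ε / 2) • Sigma⁻¹).PosDef)
    (h : SimDiag (1 + (ε / 2) • Sigma⁻¹) K T κ) (mean : EuclideanSpace ℝ ι)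
    (w : Fin n → EuclideanSpace ℝ ι) :
    ∃ C α, (∀ j, 0 ≤ α j) ∧ ∀ θ : ℝ, (∀ j, 0 < 1 - θ * κ j) →
      meanFreeEnergy ε mean Sigma w (θ • K) = energyProfile ε C α κ θ := by
  set a : Fin n → ι → ℝ := fun i =>
    Tᵀ *ᵥ ((w i).ofLp + (ε / 2) • (Sigma⁻¹ *ᵥ mean.ofLp)) with ha
  set c : Fin n → ℝ := fun i => ε * Fintype.card ι / 2 * Real.log (ε / 2)
    - ε / 2 * Real.log Sigma.det - ε / 2 * Real.log (1 + (ε / 2) • Sigma⁻¹).det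
    - ‖w i‖ ^ 2 - ε / 2 * (mean.ofLp ⬝ᵥ (Sigma⁻¹ *ᵥ mean.ofLp)) with hc
  refine ⟨(1 / n) * ∑ i, c i, fun j => (1 / n) * ∑ i, a i j ^ 2, fun j => by positivity,
    fun θ hθ => ?_⟩
  have hF : ∀ i, freeEnergy ε mean Sigma (θ • K) (w i) =
      c i + ∑ j, (a i j ^ 2 / (1 - θ * κ j) - ε / 2 * Real.log (1 - θ * κ j)) := by
    intro i
    rw [freeEnergy, h.dotProduct_inv hθ, h.det_sub_smul, Real.log_mul hS.det_pos.ne'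
      (Finset.prod_ne_zero_iff.mpr fun j _ => (hθ j).ne'),
      Real.log_prod (fun j _ => (hθ j).ne'), Finset.sum_sub_distrib, ← Finset.mul_sum]
    simp only [hc, ha]
    ring
  have hn' : (n : ℝ) ≠ 0 := by exact_mod_cast (Nat.one_le_iff_ne_zero.mp hn)
  simp only [meanFreeEnergy, hF, energyProfile]
  rw [Finset.sum_add_distrib, mul_add, Finset.sum_comm]
  refine congrArg₂ (· + ·) rfl ?_
  rw [Finset.mul_sum]
  refine Finset.sum_congr rfl fun j _ => ?_
  rw [Finset.sum_sub_distrib, ← Finset.sum_div]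
  simp only [Finset.sum_const, Finset.card_univ, Fintype.card_fin, nsmul_eq_mul]
  field_simp

omit [DecidableEq ι] in
theorem quad_smul (θ : ℝ) (K : Matrix ι ι ℝ) (y : EuclideanSpace ℝ ι) :
    quad (θ • K) y = θ * quad K y := by
  simp [quad, Matrix.smul_mulVec, dotProduct_smul]

/-- The tilted measures, with their position in the ambiguity set and their mean cost expressed
by the energy profile. -/
theorem exists_worstCase_measure (hn : 1 ≤ n) (hε : 0 < ε) (hS : Sigma.PosDef)
    (h : SimDiag (1 + (ε / 2) • Sigma⁻¹) K T κ) {C : ℝ} {α : ι → ℝ}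
    (hG : ∀ θ : ℝ, (∀ j, 0 < 1 - θ * κ j) →
      meanFreeEnergy ε mean Sigma w (θ • K) = energyProfile ε C α κ θ)
    {θ : ℝ} (hθ : ∀ j, 0 < 1 - θ * κ j) {ρ : ℝ}
    (hρ : θ * energySlope ε α κ θ - energyProfile ε C α κ θ ≤ ρ) :
    ∃ P ∈ ambiguitySet ρ ε (gaussian mean Sigma) (empirical w),
      ∫ y, quad K y ∂P = energySlope ε α κ θ := by
  obtain ⟨P, hP, hPi, hP0, hPs⟩ := exists_measure_sinkhorn_le (mean := mean) hn hε hS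
    ((h.posDef_iff θ).mpr hθ) w
  simp only [quad_smul, integral_const_mul, hG θ hθ] at hP0 hPs
  -- Weak duality for the same `P` at other parameters, taking as radius the dual value that bounds
  -- its discrepancy.
  have hsub : ∀ θ', (∀ j, 0 < 1 - θ' * κ j) →
      θ' * ∫ y, quad K y ∂P ≤ θ * ∫ y, quad K y ∂P - energyProfile ε C α κ θ
        + energyProfile ε C α κ θ' := by
    intro θ' hθ'
    have := (integral_quad_le_of_mem_ambiguitySet hn hε hS ((h.posDef_iff θ').mpr hθ') hP0
      ⟨hP, hPs⟩).2
    simpa only [quad_smul, integral_const_mul, hG θ' hθ'] using this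
  -- By `hsub` the profile lies above a line of slope `∫ quad K` touching it at `θ`. Hence the mean
  -- cost is the derivative, without computing moments of `P`.
  have hmin : IsLocalMin (fun θ' => energyProfile ε C α κ θ' - θ' * ∫ y, quad K y ∂P) θ := by
    have hev : ∀ᶠ θ' : ℝ in nhds θ, ∀ j, 0 < 1 - θ' * κ j := by
      rw [Filter.eventually_all]
      intro j
      have hc : ContinuousAt (fun η : ℝ => 1 - η * κ j) θ := by fun_prop
      exact hc.eventually_const_lt (hθ j)
    filter_upwards [hev] with θ' hθ'
    have := hsub θ' hθ'
    linarith
  have hder := hmin.hasDerivAt_eq_zero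
    ((hasDerivAt_energyProfile hθ).fun_sub ((hasDerivAt_id θ).mul_const (∫ y, quad K y ∂P)))
  rw [one_mul, sub_eq_zero] at hder
  refine ⟨P, ⟨hP, hPs.trans (ENNReal.ofReal_le_ofReal ?_)⟩, hder.symm⟩
  rw [← hder]
  exact hρ

end WorstCaseMeasure

end SinkhornControl

namespace SinkhornControl

/-! ### Existence of an admissible map -/

section Admissible

variable {d m p N n : ℕ}

/-- The block row of `noiseInput` at time `t`. -/
def noiseRow (E : Fin N → Matrix (Fin d) (Fin p) ℝ) (t : ℕ) :
    Matrix (Fin d) (NoiseIdx d p N) ℝ :=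
  Matrix.of fun i => Sum.elim (fun j => if t = 0 ∧ i = j then 1 else 0)
    (fun jk => if t = (jk.2 : ℕ) + 1 then E (Fin.castLE (Nat.sub_le N 1) jk.2) i jk.1 else 0)

/-- The response of the state at time `t` to the disturbances when no input is applied. -/
noncomputable def freeResponse (A : Fin N → Matrix (Fin d) (Fin d) ℝ)
    (E : Fin N → Matrix (Fin d) (Fin p) ℝ) : ℕ → Matrix (Fin d) (NoiseIdx d p N) ℝ
  | 0 => noiseRow E 0
  | t + 1 => (if h : t < N then A ⟨t, h⟩ * freeResponse A E t else 0) + noiseRow E (t + 1)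

theorem freeResponse_inr_eq_zero (A : Fin N → Matrix (Fin d) (Fin d) ℝ)
    (E : Fin N → Matrix (Fin d) (Fin p) ℝ) (j : Fin p) (k : Fin (N - 1)) (t : ℕ)
    (ht : t < (k : ℕ) + 1) (i : Fin d) : freeResponse A E t i (Sum.inr (j, k)) = 0 := by
  induction t generalizing i with
  | zero => simp [freeResponse, noiseRow]
  | succ t ih =>
    have hk : t ≠ (k : ℕ) := by omega
    have ih' := ih (by omega)
    rw [freeResponse]
    split_ifs with h
    · simp [noiseRow, hk, Matrix.mul_apply, ih']
    · simp [noiseRow, hk]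

/-- The closed-loop map without inputs. -/
noncomputable def freeMap (m : ℕ) (A : Fin N → Matrix (Fin d) (Fin d) ℝ)
    (E : Fin N → Matrix (Fin d) (Fin p) ℝ) : ClosedLoopMap d m p N :=
  Matrix.fromRows (Matrix.of fun a => freeResponse A E a.2 a.1) 0

theorem isCausal_freeMap (A : Fin N → Matrix (Fin d) (Fin d) ℝ)
    (E : Fin N → Matrix (Fin d) (Fin p) ℝ) : IsCausal (freeMap m A E) := fun t k j ht =>
  ⟨fun i => freeResponse_inr_eq_zero A E j k t ht i, fun _ => rfl⟩

/-- With zero input the constraint is `(I - Z𝐀) Φₓ = 𝐄`, whose block rows are the recursion defining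
`freeResponse`. -/
theorem isAchievable_freeMap (A : Fin N → Matrix (Fin d) (Fin d) ℝ)
    (B : Fin N → Matrix (Fin d) (Fin m) ℝ) (E : Fin N → Matrix (Fin d) (Fin p) ℝ) :
    IsAchievable A B E (freeMap m A E) := by
  rw [IsAchievable, freeMap, Matrix.fromCols_mul_fromRows, Matrix.mul_zero, add_zero,
    Matrix.sub_mul, Matrix.one_mul, Matrix.mul_assoc]
  ext ⟨i, t⟩ j
  have hN : noiseInput E (i, t) j = noiseRow E t i j := rfl
  have hAX : ∀ (i' : Fin d) (t' : Fin N), (Matrix.blockDiagonal A *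
      (Matrix.of fun a : StateIdx d N => freeResponse A E a.2 a.1)) (i', t') j =
      (A t' * freeResponse A E t') i' j := by
    intro i' t'
    simp [Matrix.mul_apply, Fintype.sum_prod_type_right, Matrix.blockDiagonal_apply, ite_mul]
  rw [hN, Matrix.sub_apply, Matrix.mul_apply, Fintype.sum_prod_type_right]
  simp only [hAX, downshift, Matrix.of_apply]
  obtain ⟨t, ht⟩ := t
  cases t with
  | zero => simp [freeResponse]
  | succ t =>
    have htN : t < N := by omega
    have : ∀ t' : Fin N, t = (t' : ℕ) ↔ (⟨t, htN⟩ : Fin N) = t' := fun t' => by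
      rw [Fin.ext_iff]
    simp [freeResponse, htN, this, ite_and, ite_mul]

/-- The zero-input map is achievable and causal, so feasibility depends on the ambiguity set alone.
-/
theorem Data.admissible_nonempty (pb : Data d m p N n) {𝒮 : Set (ClosedLoopMap d m p N)}
    (h𝒮 : 𝒮 = Set.univ ∨ 𝒮 = {Φ | IsCausal Φ}) : (pb.admissible 𝒮).Nonempty := by
  refine ⟨freeMap m pb.A pb.E, ?_, isAchievable_freeMap _ _ _⟩
  rcases h𝒮 with rfl | rfl
  · trivial
  · exact isCausal_freeMap _ _

end Admissible

/-! ### Scaling by the multiplier -/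

section ScaledFreeEnergy

variable {ι : Type*} [Fintype ι] [DecidableEq ι] {mean : EuclideanSpace ℝ ι}
  {Sigma Q : Matrix ι ι ℝ} {ε lam : ℝ}

omit [Fintype ι] [DecidableEq ι] in
theorem smul_sub_eq_smul (hlam : 0 < lam) (S : Matrix ι ι ℝ) :
    lam • S - Q = lam • (S - lam⁻¹ • Q) := by
  rw [smul_sub, smul_smul, mul_inv_cancel₀ hlam.ne', one_smul]

omit [Fintype ι] [DecidableEq ι] in
theorem posDef_sub_inv_smul {S : Matrix ι ι ℝ} (hlam : 0 < lam) (hM : (lam • S - Q).PosDef) :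
    (S - lam⁻¹ • Q).PosDef := by
  have := hM.smul (inv_pos.mpr hlam)
  rwa [smul_sub_eq_smul hlam, smul_smul, inv_mul_cancel₀ hlam.ne', one_smul] at this

/-- `det (lam A) = lam ^ s * det A` turns `log (ε / 2)` into `log (lam ε / 2)`. The result is the
least `sᵢ` left by the constraints once `ζᵢ` is eliminated. -/
theorem mul_freeEnergy_inv_smul (hε : 0 < ε) (hlam : 0 < lam)
    (hM : (lam • (1 + (ε / 2) • Sigma⁻¹) - Q).PosDef) (x : EuclideanSpace ℝ ι) :
    lam * freeEnergy ε mean Sigma (lam⁻¹ • Q) x =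
      lam * ε * Fintype.card ι / 2 * Real.log (lam * ε / 2) - lam * ε / 2 * Real.log Sigma.det
      - lam * ε / 2 * Real.log (lam • (1 + (ε / 2) • Sigma⁻¹) - Q).det
      + ((lam • x.ofLp + (lam * ε / 2) • (Sigma⁻¹ *ᵥ mean.ofLp)) ⬝ᵥ
          ((lam • (1 + (ε / 2) • Sigma⁻¹) - Q)⁻¹ *ᵥ
            (lam • x.ofLp + (lam * ε / 2) • (Sigma⁻¹ *ᵥ mean.ofLp)))
        - (lam * ‖x‖ ^ 2 + lam * ε / 2 * (mean.ofLp ⬝ᵥ (Sigma⁻¹ *ᵥ mean.ofLp)))) := by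
  have hA := posDef_sub_inv_smul hlam hM
  rw [smul_sub_eq_smul hlam, freeEnergy]
  set A := 1 + (ε / 2) • Sigma⁻¹ - lam⁻¹ • Q with hAdef
  have hinv : (lam • A)⁻¹ = lam⁻¹ • A⁻¹ := by
    have := Matrix.inv_smul' (k := Units.mk0 lam hlam.ne') (A := A) hA.det_pos.ne'.isUnit
    simpa [Units.smul_def] using this
  have hv : lam • x.ofLp + (lam * ε / 2) • (Sigma⁻¹ *ᵥ mean.ofLp) =
      lam • (x.ofLp + (ε / 2) • (Sigma⁻¹ *ᵥ mean.ofLp)) := by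
    rw [smul_add, smul_smul, mul_div_assoc]
  rw [hinv, hv, Matrix.det_smul, Real.log_mul (by positivity) hA.det_pos.ne', Real.log_pow,
    mul_div_assoc lam ε 2, Real.log_mul hlam.ne' (by positivity)]
  simp only [Matrix.smul_mulVec, Matrix.mulVec_smul, dotProduct_smul, smul_dotProduct, smul_eq_mul]
  field_simp
  ring

end ScaledFreeEnergy

/-! ### The finite-dimensional program and strong duality -/

section Program

variable {d m p N n : ℕ} {pb : Data d m p N n} {𝒮 : Set (ClosedLoopMap d m p N)}

theorem card_noiseIdx : Fintype.card (NoiseIdx d p N) = d + (N - 1) * p := by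
  simp [mul_comm]

theorem Data.posDef_one_add (hSigma : pb.Sigma.PosDef) (hε : 0 < pb.ε) :
    (1 + (pb.ε / 2) • pb.Sigma⁻¹).PosDef :=
  Matrix.PosDef.one.add (hSigma.inv.smul (by positivity))

/-- The mean free energy of the problem data. -/
noncomputable def Data.energy (pb : Data d m p N n)
    (K : Matrix (NoiseIdx d p N) (NoiseIdx d p N) ℝ) : ℝ :=
  meanFreeEnergy pb.ε pb.mean pb.Sigma pb.w K

/-- `Σ + (ε/2) I = Σ (I + (ε/2) Σ⁻¹)` merges the two log-determinants of the free energy at `K = 0`.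
-/
theorem Data.minRadius_eq_neg_energy (hn : 1 ≤ n) (hSigma : pb.Sigma.PosDef) (hε : 0 < pb.ε) :
    pb.minRadius = -pb.energy 0 := by
  have hdet : (pb.Sigma + (pb.ε / 2) • (1 : Matrix _ _ ℝ)).det =
      pb.Sigma.det * (1 + (pb.ε / 2) • pb.Sigma⁻¹).det := by
    rw [← Matrix.det_mul, Matrix.mul_add, Matrix.mul_one, Matrix.mul_smul,
      Matrix.mul_nonsing_inv _ hSigma.det_pos.ne'.isUnit]
  have hn' : (n : ℝ) ≠ 0 := by exact_mod_cast (Nat.one_le_iff_ne_zero.mp hn)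
  rw [minRadius, hdet, Real.log_mul hSigma.det_pos.ne' (pb.posDef_one_add hSigma hε).det_pos.ne',
    energy, meanFreeEnergy, ← card_noiseIdx]
  simp only [freeEnergy, sub_zero]
  rw [Finset.sum_sub_distrib, Finset.sum_sub_distrib, Finset.sum_add_distrib]
  simp only [Finset.sum_const, Finset.card_univ, Fintype.card_fin, nsmul_eq_mul]
  field_simp
  ring

theorem Data.posSemidef_costMatrix (hD : pb.D.PosSemidef) (Φ : ClosedLoopMap d m p N) :
    (pb.costMatrix Φ).PosSemidef :=
  posSemidef_transpose_mul_mul_same hD Φ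

theorem Data.costLMI_iff (hD : pb.D.PosSemidef) (x : Decision d m p N n) :
    pb.CostLMI x ↔ (x.Q - pb.costMatrix x.Φ).PosSemidef :=
  posSemidef_fromBlocks_sqrt_iff hD _ _

/-- The right-hand side of the quadratic term in the `i`-th sample constraint. -/
noncomputable def Data.offset (pb : Data d m p N n) (lam : ℝ) (i : Fin n) : ℝ :=
  lam * ‖pb.w i‖ ^ 2 + lam * pb.ε / 2 * (pb.mean.ofLp ⬝ᵥ (pb.Sigma⁻¹ *ᵥ pb.mean.ofLp))

/-- The vector `vᵢ`. -/
noncomputable def Data.shift (pb : Data d m p N n) (lam : ℝ) (i : Fin n) :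
    NoiseIdx d p N → ℝ :=
  lam • (pb.w i).ofLp + (lam * pb.ε / 2) • (pb.Sigma⁻¹ *ᵥ pb.mean.ofLp)

theorem Data.sampleLMI_iff {x : Decision d m p N n} (hM : (pb.M x).PosDef) (i : Fin n) :
    pb.SampleLMI x i ↔ pb.shift x.lam i ⬝ᵥ ((pb.M x)⁻¹ *ᵥ pb.shift x.lam i) ≤
      x.ζ i + pb.offset x.lam i := by
  rw [offset, ← add_assoc]
  exact posSemidef_fromBlocks_replicate_iff hM _ _

theorem quad_nonneg {ι : Type*} [Fintype ι] {K : Matrix ι ι ℝ} (hK : K.PosSemidef)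
    (y : EuclideanSpace ℝ ι) : 0 ≤ quad K y := by
  have := hK.dotProduct_mulVec_nonneg y.ofLp
  rwa [star_trivial] at this

theorem Data.coe_lintegral_cost {K : Matrix (NoiseIdx d p N) (NoiseIdx d p N) ℝ}
    (hK : K.PosSemidef) {P : Measure (Noise d p N)} (hP : Integrable (fun y => ‖y‖ ^ 2) P) :
    ((∫⁻ w, ENNReal.ofReal (w.ofLp ⬝ᵥ (K *ᵥ w.ofLp)) ∂P : ℝ≥0∞) : EReal) =
      ((∫ y, quad K y ∂P : ℝ) : EReal) := by
  have h := ofReal_integral_eq_lintegral_ofReal (integrable_quad K hP)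
    (ae_of_all _ (quad_nonneg hK))
  change ((∫⁻ w, ENNReal.ofReal (quad K w) ∂P : ℝ≥0∞) : EReal) = _
  rw [← h, EReal.coe_ennreal_ofReal, max_eq_left (integral_nonneg (quad_nonneg hK))]

/-- For `K = 0` weak duality reads `0 ≤ ρ + energy 0`, and the tilted measure has discrepancy at
most `-energy 0`. -/
theorem Data.ball_nonempty_iff (hn : 1 ≤ n) (hSigma : pb.Sigma.PosDef) (hρ : 0 ≤ pb.ρ)
    (hε : 0 < pb.ε) : pb.ball.Nonempty ↔ pb.minRadius ≤ pb.ρ := by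
  have hS : (1 + (pb.ε / 2) • pb.Sigma⁻¹ - 0).PosDef := by
    rw [sub_zero]; exact pb.posDef_one_add hSigma hε
  have hq : ∀ P : Measure (Noise d p N), ∫ y, quad 0 y ∂P = 0 := fun P => by simp [quad]
  rw [pb.minRadius_eq_neg_energy hn hSigma hε]
  constructor
  · rintro ⟨P, hP⟩
    have := (integral_quad_le_of_mem_ambiguitySet hn hε hSigma hS hρ hP).2
    rw [hq] at this
    rw [energy]
    linarith
  · intro h
    obtain ⟨P, hP, -, -, hs⟩ := exists_measure_sinkhorn_le (mean := pb.mean) hn hε hSigma hS pb.w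
    rw [hq, zero_sub] at hs
    exact ⟨P, hP, hs.trans (ENNReal.ofReal_le_ofReal h)⟩

/-- At `lam = 0` a diagonal entry of `M = -Q` would be both positive and nonpositive. So `lam = 0`
survives only in dimension zero. -/
theorem Data.isEmpty_of_lam_eq_zero {x : Decision d m p N n} (h0 : x.lam = 0)
    (hQ : x.Q.PosSemidef) (hM : (pb.M x).PosDef) : IsEmpty (NoiseIdx d p N) := by
  refine ⟨fun j => ?_⟩
  have h1 := hM.diag_pos (i := j)
  have h2 := hQ.diag_nonneg (i := j)
  simp only [M, h0, zero_smul, zero_sub, Matrix.neg_apply] at h1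
  linarith

/-- The Schur complement bounds `ζᵢ` from below and the log-determinant constraint then bounds `sᵢ`;
averaging over the samples gives the energy. -/
theorem Data.mul_energy_le (hn : 1 ≤ n) (hε : 0 < pb.ε) {x : Decision d m p N n}
    (hx : x ∈ pb.program 𝒮) (hlam : 0 < x.lam) :
    x.lam * (pb.ρ + pb.energy (x.lam⁻¹ • x.Q)) ≤ pb.objective x := by
  obtain ⟨-, -, hM, hL, hI, -, -⟩ := hx
  have hle : ∀ i, x.lam * freeEnergy pb.ε pb.mean pb.Sigma (x.lam⁻¹ • x.Q) (pb.w i) ≤ x.s i := by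
    intro i
    have h1 := hL i
    have h2 := (sampleLMI_iff hM i).mp (hI i)
    rw [LogDet, ← card_noiseIdx] at h1
    rw [mul_freeEnergy_inv_smul hε hlam hM]
    simp only [M, shift, offset] at h1 h2
    linarith
  rw [objective, mul_add, energy, meanFreeEnergy, mul_left_comm, Finset.mul_sum]
  exact add_le_add_right (mul_le_mul_of_nonneg_left (Finset.sum_le_sum fun i _ => hle i)
    (by positivity)) _

/-- Weak duality between the min-max problem and the program. -/
theorem Data.worstCase_le_objective (hn : 1 ≤ n) (hD : pb.D.PosSemidef)
    (hSigma : pb.Sigma.PosDef) (hρ : 0 ≤ pb.ρ) (hε : 0 < pb.ε) {x : Decision d m p N n}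
    (hx : x ∈ pb.program 𝒮) : pb.worstCase x.Φ ≤ (pb.objective x : EReal) := by
  have hobj := pb.mul_energy_le (𝒮 := 𝒮) hn hε hx
  obtain ⟨hlam, hQ, hM, hL, hI, hC, -⟩ := hx
  have hK := pb.posSemidef_costMatrix hD x.Φ
  have hQK := (pb.costLMI_iff hD x).mp hC
  refine iSup₂_le fun P hP => ?_
  have hS : (1 + (pb.ε / 2) • pb.Sigma⁻¹ - 0).PosDef := by
    rw [sub_zero]; exact pb.posDef_one_add hSigma hε
  have hPi := (integral_quad_le_of_mem_ambiguitySet hn hε hSigma hS hρ hP).1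
  rw [coe_lintegral_cost hK hPi, EReal.coe_le_coe_iff]
  rcases hlam.eq_or_lt with h0 | hlam
  -- In dimension zero the cost vanishes and the constraints reduce to `0 ≤ ζᵢ ≤ sᵢ`.
  · have hemp := pb.isEmpty_of_lam_eq_zero h0.symm hQ hM
    have hq : ∀ y, quad (pb.costMatrix x.Φ) y = 0 := fun y => by simp [quad, dotProduct]
    simp only [hq, integral_zero, objective, ← h0, zero_mul, zero_add]
    refine mul_nonneg (by positivity) (Finset.sum_nonneg fun i _ => ?_)
    have h1 := hL i
    have h2 := (sampleLMI_iff hM i).mp (hI i)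
    simp only [LogDet, ← h0, offset, dotProduct, Finset.univ_eq_empty, Finset.sum_empty] at h1 h2
    simp only [zero_mul, zero_div] at h1 h2
    linarith
  · have hw := integral_quad_le_of_mem_ambiguitySet hn hε hSigma (posDef_sub_inv_smul hlam hM) hρ hP
    have h1 : ∫ y, quad (pb.costMatrix x.Φ) y ∂P ≤ ∫ y, quad x.Q y ∂P := by
      refine integral_mono (integrable_quad _ hPi) (integrable_quad _ hPi) fun y => ?_
      have := quad_nonneg hQK y
      simp only [quad, Matrix.sub_mulVec, dotProduct_sub] at this ⊢
      linarith
    have h2 := mul_le_mul_of_nonneg_left hw.2 hlam.le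
    simp only [quad_smul, integral_const_mul, mul_inv_cancel_left₀ hlam.ne'] at h2
    exact h1.trans (h2.trans (hobj hlam))

/-- Choose `ζᵢ` and `sᵢ` as small as the constraints allow, so that both hold with equality. -/
theorem Data.exists_mem_exactProgram (hD : pb.D.PosSemidef) (hε : 0 < pb.ε)
    {Φ : ClosedLoopMap d m p N} (hΦ : Φ ∈ pb.admissible 𝒮) {lam : ℝ} (hlam : 0 < lam)
    (hM : (lam • (1 + (pb.ε / 2) • pb.Sigma⁻¹) - pb.costMatrix Φ).PosDef) :
    ∃ x ∈ pb.exactProgram 𝒮, x.Φ = Φ ∧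
      pb.objective x = lam * (pb.ρ + pb.energy (lam⁻¹ • pb.costMatrix Φ)) := by
  let x : Decision d m p N n :=
    { lam := lam
      Q := pb.costMatrix Φ
      s := fun i => lam * freeEnergy pb.ε pb.mean pb.Sigma (lam⁻¹ • pb.costMatrix Φ) (pb.w i)
      ζ := fun i => pb.shift lam i ⬝ᵥ ((lam • (1 + (pb.ε / 2) • pb.Sigma⁻¹) -
        pb.costMatrix Φ)⁻¹ *ᵥ pb.shift lam i) - pb.offset lam i
      Φ := Φ }
  have hMx : (pb.M x).PosDef := hM
  refine ⟨x, ⟨⟨hlam.le, pb.posSemidef_costMatrix hD Φ, hMx, fun i => ?_, fun i => ?_, ?_, hΦ⟩, rfl⟩,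
    rfl, ?_⟩
  · rw [LogDet, ← card_noiseIdx]
    exact (mul_freeEnergy_inv_smul hε hlam hM _).ge
  · rw [sampleLMI_iff hMx]
    exact (sub_add_cancel _ _).ge
  · rw [pb.costLMI_iff hD]
    simp only [x, sub_self]
    exact Matrix.PosSemidef.zero
  · simp only [x, objective, energy, meanFreeEnergy, ← Finset.mul_sum]
    ring

theorem Data.integral_le_worstCase (hn : 1 ≤ n) (hD : pb.D.PosSemidef) (hSigma : pb.Sigma.PosDef)
    (hρ : 0 ≤ pb.ρ) (hε : 0 < pb.ε) (Φ : ClosedLoopMap d m p N) {P : Measure (Noise d p N)}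
    (hP : P ∈ pb.ball) :
    ((∫ y, quad (pb.costMatrix Φ) y ∂P : ℝ) : EReal) ≤ pb.worstCase Φ := by
  have hS : (1 + (pb.ε / 2) • pb.Sigma⁻¹ - 0).PosDef := by
    rw [sub_zero]; exact pb.posDef_one_add hSigma hε
  have hPi := (integral_quad_le_of_mem_ambiguitySet hn hε hSigma hS hρ hP).1
  rw [← coe_lintegral_cost (pb.posSemidef_costMatrix hD Φ) hPi]
  exact le_iSup₂_of_le P hP le_rfl

/-- Strong duality with attainment, for nonzero cost and a radius in the interior. -/
theorem Data.exists_objective_le_worstCase (hn : 1 ≤ n) (hD : pb.D.PosSemidef)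
    (hSigma : pb.Sigma.PosDef) (hρ : 0 ≤ pb.ρ) (hε : 0 < pb.ε) (hmin : pb.minRadius < pb.ρ)
    {Φ : ClosedLoopMap d m p N} (hΦ : Φ ∈ pb.admissible 𝒮) (h0 : pb.costMatrix Φ ≠ 0) :
    ∃ x ∈ pb.exactProgram 𝒮, x.Φ = Φ ∧ (pb.objective x : EReal) ≤ pb.worstCase Φ := by
  have hS := pb.posDef_one_add hSigma hε
  have hK := pb.posSemidef_costMatrix hD Φ
  obtain ⟨T, κ, h⟩ := exists_simDiag hS hK.isHermitian
  obtain ⟨C, α, hα, hG⟩ := exists_meanFreeEnergy_eq hn hS h pb.mean pb.w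
  have hG0 : energyProfile pb.ε C α κ 0 = pb.energy 0 := by
    rw [← hG 0 (by simp), zero_smul, energy]
  rw [pb.minRadius_eq_neg_energy hn hSigma hε, ← hG0] at hmin
  -- The optimal multiplier is `lam = θ⁻¹`: there `θ⁻¹ (ρ + g(θ)) = g'(θ)` is the mean cost of a
  -- measure in the ball.
  obtain ⟨θ, hθ0, hθ, hθρ⟩ := exists_legendre_eq hε hα (h.nonneg hK) (h.ne_zero h0) hmin
  obtain ⟨P, hP, hPK⟩ := exists_worstCase_measure (mean := pb.mean) hn hε hSigma h hG hθ hθρ.le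
  have hM : (θ⁻¹ • (1 + (pb.ε / 2) • pb.Sigma⁻¹) - pb.costMatrix Φ).PosDef := by
    rw [smul_sub_eq_smul (inv_pos.mpr hθ0), inv_inv]
    exact ((h.posDef_iff θ).mpr hθ).smul (inv_pos.mpr hθ0)
  obtain ⟨x, hx, hxΦ, hobj⟩ := pb.exists_mem_exactProgram hD hε hΦ (inv_pos.mpr hθ0) hM
  refine ⟨x, hx, hxΦ, le_trans ?_ (pb.integral_le_worstCase hn hD hSigma hρ hε Φ hP)⟩
  rw [EReal.coe_le_coe_iff, hobj, hPK, inv_inv, energy, hG θ hθ, ← hθρ, sub_add_cancel,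
    inv_mul_cancel_left₀ hθ0.ne']

/-- Strong duality. -/
theorem Data.exists_objective_le_worstCase_add (hn : 1 ≤ n) (hD : pb.D.PosSemidef)
    (hSigma : pb.Sigma.PosDef) (hρ : 0 ≤ pb.ρ) (hε : 0 < pb.ε) (hmin : pb.minRadius ≤ pb.ρ)
    {Φ : ClosedLoopMap d m p N} (hΦ : Φ ∈ pb.admissible 𝒮) {δ : ℝ} (hδ : 0 < δ) :
    ∃ x ∈ pb.program 𝒮, x.Φ = Φ ∧ (pb.objective x : EReal) ≤ pb.worstCase Φ + δ := by
  have hS := pb.posDef_one_add hSigma hε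
  have hK := pb.posSemidef_costMatrix hD Φ
  by_cases h0 : pb.costMatrix Φ = 0
  · obtain ⟨P, hP⟩ := (pb.ball_nonempty_iff hn hSigma hρ hε).mpr hmin
    -- For zero cost the objective is `lam (ρ - ρ_min)`, so a small `lam` suffices; the `+ 1` keeps
    -- the denominator positive when `ρ = ρ_min`.
    have hr : 0 < pb.ρ - pb.minRadius + 1 := by linarith
    have hlam : 0 < δ / (pb.ρ - pb.minRadius + 1) := by positivity
    have hM : ((δ / (pb.ρ - pb.minRadius + 1)) • (1 + (pb.ε / 2) • pb.Sigma⁻¹) -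
        pb.costMatrix Φ).PosDef := by
      rw [h0, sub_zero]
      exact hS.smul hlam
    obtain ⟨x, hx, hxΦ, hobj⟩ := pb.exists_mem_exactProgram hD hε hΦ hlam hM
    refine ⟨x, hx.1, hxΦ, ?_⟩
    have h1 := pb.integral_le_worstCase hn hD hSigma hρ hε Φ hP
    have hq : ∀ y, quad (pb.costMatrix Φ) y = 0 := fun y => by simp [quad, h0]
    simp only [hq, integral_zero, EReal.coe_zero] at h1
    have h2 : pb.objective x ≤ δ := by
      rw [hobj, h0, smul_zero, ← neg_neg (pb.energy 0), ← pb.minRadius_eq_neg_energy hn hSigma hε,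
        ← sub_eq_add_neg, div_mul_eq_mul_div, div_le_iff₀ hr]
      nlinarith
    calc (pb.objective x : EReal) ≤ (δ : EReal) := EReal.coe_le_coe_iff.mpr h2
      _ = 0 + δ := (zero_add _).symm
      _ ≤ _ := add_le_add_left h1 _
  rcases hmin.lt_or_eq with hlt | heq
  · obtain ⟨x, hx, hxΦ, hobj⟩ :=
      pb.exists_objective_le_worstCase hn hD hSigma hρ hε hlt hΦ h0
    refine ⟨x, hx.1, hxΦ, hobj.trans ?_⟩
    exact le_add_of_nonneg_right (EReal.coe_nonneg.mpr hδ.le)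
  -- At `ρ = ρ_min` the untilted case `θ = 0` gives a measure in the ball with mean cost `g'(0)`,
  -- while the objective at `lam = θ⁻¹` is the difference quotient `(g(θ) - g(0)) / θ`, which tends
  -- to `g'(0)` as `θ ↓ 0`.
  · obtain ⟨T, κ, h⟩ := exists_simDiag hS hK.isHermitian
    obtain ⟨C, α, hα, hG⟩ := exists_meanFreeEnergy_eq hn hS h pb.mean pb.w
    have hdom : ∀ j, 0 < 1 - (0 : ℝ) * κ j := by simp
    have hG0 : energyProfile pb.ε C α κ 0 = pb.energy 0 := by
      rw [← hG 0 hdom, zero_smul, energy]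
    rw [pb.minRadius_eq_neg_energy hn hSigma hε, ← hG0] at heq
    obtain ⟨P, hP, hPK⟩ := exists_worstCase_measure (mean := pb.mean) hn hε hSigma h hG hdom
      (ρ := pb.ρ) (by simp [heq])
    have hV := pb.integral_le_worstCase hn hD hSigma hρ hε Φ hP
    rw [hPK] at hV
    have htend := (hasDerivAt_energyProfile (ε := pb.ε) (C := C) (α := α) hdom).tendsto_slope_zero_right
    have hev : ∀ᶠ θ : ℝ in nhdsWithin 0 (Set.Ioi 0), ∀ j, 0 < 1 - θ * κ j := by
      rw [Filter.eventually_all]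
      intro j
      have hc : ContinuousAt (fun η : ℝ => 1 - η * κ j) 0 := by fun_prop
      exact (hc.eventually_const_lt (by simp)).filter_mono nhdsWithin_le_nhds
    obtain ⟨θ, ⟨hθ1, hθ⟩, hθ0⟩ := (((htend.eventually_lt_const
      (show energySlope pb.ε α κ 0 < energySlope pb.ε α κ 0 + δ by linarith)).and hev).and
      self_mem_nhdsWithin).exists
    replace hθ0 : 0 < θ := hθ0
    have hM : (θ⁻¹ • (1 + (pb.ε / 2) • pb.Sigma⁻¹) - pb.costMatrix Φ).PosDef := by
      rw [smul_sub_eq_smul (inv_pos.mpr hθ0), inv_inv]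
      exact ((h.posDef_iff θ).mpr hθ).smul (inv_pos.mpr hθ0)
    obtain ⟨x, hx, hxΦ, hobj⟩ := pb.exists_mem_exactProgram hD hε hΦ (inv_pos.mpr hθ0) hM
    refine ⟨x, hx.1, hxΦ, le_trans ?_ (add_le_add_left hV _)⟩
    rw [← EReal.coe_add, EReal.coe_le_coe_iff, hobj, inv_inv, energy, hG θ hθ, ← heq]
    rw [zero_add, smul_eq_mul] at hθ1
    linarith

/-- Replacing `Q` by `Φᵀ D Φ` preserves feasibility. -/
theorem Data.exact_mem_exactProgram (hD : pb.D.PosSemidef) (hε : 0 < pb.ε)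
    {x : Decision d m p N n} (hx : x ∈ pb.program 𝒮) :
    { x with Q := pb.costMatrix x.Φ } ∈ pb.exactProgram 𝒮 := by
  obtain ⟨hlam, hQ, hM, hL, hI, hC, hΦ⟩ := hx
  set y : Decision d m p N n := { x with Q := pb.costMatrix x.Φ } with hy
  have hQK := (pb.costLMI_iff hD x).mp hC
  -- Lowering `Q` raises `M`: the log-determinant can only grow, and each sample inequality gains a
  -- positive semidefinite block.
  have hMM : (pb.M y - pb.M x).PosSemidef := by
    have : pb.M y - pb.M x = x.Q - pb.costMatrix x.Φ := by
      simp only [M, hy]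
      abel
    rwa [this]
  have hMy : (pb.M y).PosDef := posDef_of_posSemidef_sub hM hMM
  refine ⟨⟨hlam, pb.posSemidef_costMatrix hD _, hMy, fun i => ?_, fun i => ?_, ?_, hΦ⟩, rfl⟩
  · have h1 := hL i
    have h2 := Real.log_le_log hM.det_pos (det_le_det_of_posSemidef_sub hM hMM)
    have h3 := mul_le_mul_of_nonneg_left h2
      (show 0 ≤ x.lam * pb.ε / 2 by positivity)
    simp only [LogDet] at h1 ⊢
    linarith
  · have h1 := hI i
    simp only [SampleLMI] at h1 ⊢
    have h2 : (Matrix.fromBlocks (pb.M y - pb.M x) 0 0 (0 : Matrix Unit Unit ℝ)).PosSemidef := by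
      have := hMM.mul_mul_conjTranspose_same
        (Matrix.fromRows 1 0 : Matrix (NoiseIdx d p N ⊕ Unit) (NoiseIdx d p N) ℝ)
      rw [Matrix.conjTranspose_fromRows_eq_fromCols_conjTranspose, Matrix.fromRows_mul,
        Matrix.fromRows_mul_fromCols] at this
      simpa using this
    have h3 := h1.add h2
    rw [Matrix.fromBlocks_add, add_sub_cancel, add_zero, add_zero, add_zero] at h3
    exact h3
  · rw [pb.costLMI_iff hD]
    simp only [hy, sub_self]
    exact Matrix.PosSemidef.zero

end Program

end SinkhornControl

/-! ### The main theorem -/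

open SinkhornControl in
theorem theorem1 {d m p N n : ℕ} (hN : 1 ≤ N) (hn : 1 ≤ n) (pb : Data d m p N n)
    (hD : pb.D.PosSemidef) (hSigma : pb.Sigma.PosDef) (hρ : 0 ≤ pb.ρ) (hε : 0 < pb.ε)
    (𝒮 : Set (ClosedLoopMap d m p N))
    (h𝒮 : 𝒮 = Set.univ ∨ 𝒮 = {Φ | IsCausal Φ}) :
    -- feasibility
    (pb.Feasible 𝒮 ↔ pb.minRadius ≤ pb.ρ) ∧
    -- exactness of the program
    (pb.minRadius ≤ pb.ρ →
      -- for every fixed closed-loop map, and for the optimal values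
      (∀ Φ ∈ pb.admissible 𝒮, pb.worstCase Φ ≠ ⊤ ∧
        pb.worstCase Φ = pb.optValue {x | x ∈ pb.program 𝒮 ∧ x.Φ = Φ}) ∧
      pb.robustValue 𝒮 = pb.optValue (pb.program 𝒮) ∧
      -- minimizers of the program give optimal maps
      (∀ x, pb.IsMinimizer (pb.program 𝒮) x → pb.IsOptimalMap 𝒮 x.Φ) ∧
      -- optimal maps are the `Φ`-components of minimizing sequences of the program ...
      (∀ Φ, pb.IsOptimalMap 𝒮 Φ ↔ ∀ δ : ℝ, 0 < δ → ∃ x ∈ pb.program 𝒮, x.Φ = Φ ∧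
        ∀ y ∈ pb.program 𝒮, pb.objective x ≤ pb.objective y + δ) ∧
      -- ... and of minimizers, outside the degenerate cases
      (pb.minRadius < pb.ρ → ∀ Φ, pb.IsOptimalMap 𝒮 Φ → pb.costMatrix Φ ≠ 0 →
        ∃ x, pb.IsMinimizer (pb.program 𝒮) x ∧ x.Φ = Φ)) ∧
    -- the relaxation of `Q = Φᵀ D Φ` to `Q ⪰ Φᵀ D Φ` is exact
    (∀ x : Decision d m p N n, pb.CostLMI x ↔ (x.Q - pb.costMatrix x.Φ).PosSemidef) ∧
    pb.optValue (pb.exactProgram 𝒮) = pb.optValue (pb.program 𝒮) ∧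
    (∀ x, pb.IsMinimizer (pb.program 𝒮) x →
      pb.IsMinimizer (pb.exactProgram 𝒮) { x with Q := pb.costMatrix x.Φ }) ∧
    (∀ x, pb.IsMinimizer (pb.exactProgram 𝒮) x → pb.IsMinimizer (pb.program 𝒮) x) := by
  have hweak : ∀ x ∈ pb.program 𝒮, pb.worstCase x.Φ ≤ (pb.objective x : EReal) := fun x hx =>
    pb.worstCase_le_objective hn hD hSigma hρ hε hx
  have hexact : ∀ x ∈ pb.program 𝒮, { x with Q := pb.costMatrix x.Φ } ∈ pb.exactProgram 𝒮 :=
    fun x hx => pb.exact_mem_exactProgram hD hε hx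
  refine ⟨⟨fun h => (pb.ball_nonempty_iff hn hSigma hρ hε).mp h.2, fun h =>
    ⟨pb.admissible_nonempty h𝒮, (pb.ball_nonempty_iff hn hSigma hρ hε).mpr h⟩⟩,
    fun hmin => ?_, pb.costLMI_iff hD, ?_, ?_, ?_⟩
  · have hstrong : ∀ Φ ∈ pb.admissible 𝒮, ∀ δ : ℝ, 0 < δ →
        ∃ x ∈ pb.program 𝒮, x.Φ = Φ ∧ (pb.objective x : EReal) ≤ pb.worstCase Φ + δ :=
      fun Φ hΦ δ hδ => pb.exists_objective_le_worstCase_add hn hD hSigma hρ hε hmin hΦ hδ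
    have hvalue : ∀ Φ ∈ pb.admissible 𝒮,
        pb.worstCase Φ = pb.optValue {x | x ∈ pb.program 𝒮 ∧ x.Φ = Φ} := by
      intro Φ hΦ
      refine le_antisymm (le_iInf₂ ?_) ?_
      · rintro x ⟨hx, rfl⟩
        exact hweak x hx
      · refine EReal.le_of_forall_lt_iff_le.mp fun z hz => ?_
        obtain ⟨x₀, hx₀, rfl, -⟩ := hstrong Φ hΦ 1 one_pos
        have hbot : pb.worstCase x₀.Φ ≠ ⊥ := by
          obtain ⟨P, hP⟩ := (pb.ball_nonempty_iff hn hSigma hρ hε).mpr hmin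
          intro h
          have := pb.integral_le_worstCase hn hD hSigma hρ hε x₀.Φ hP
          rw [h, le_bot_iff] at this
          exact EReal.coe_ne_bot _ this
        -- The worst case is finite: weak duality bounds it above, and any measure in the ball
        -- bounds it below. This permits the real slack `z - v`.
        lift pb.worstCase x₀.Φ to ℝ using ⟨ne_top_of_le_ne_top (EReal.coe_ne_top _)
          (hweak x₀ hx₀), hbot⟩ with v hv
        rw [EReal.coe_lt_coe_iff] at hz
        obtain ⟨x, hx, hxΦ, hle⟩ := hstrong x₀.Φ hΦ (z - v) (sub_pos.mpr hz)
        rw [← hv, ← EReal.coe_add, add_sub_cancel] at hle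
        exact iInf₂_le_of_le x ⟨hx, hxΦ⟩ hle
    have hopt : ∀ Φ, pb.IsOptimalMap 𝒮 Φ → ∀ y ∈ pb.program 𝒮,
        pb.worstCase Φ ≤ (pb.objective y : EReal) := fun Φ hΦ y hy =>
      (hΦ.2 hy.2.2.2.2.2.2).trans (hweak y hy)
    refine ⟨fun Φ hΦ => ⟨?_, hvalue Φ hΦ⟩, ?_, ?_, fun Φ => ⟨?_, ?_⟩, ?_⟩
    · obtain ⟨x, hx, rfl, -⟩ := hstrong Φ hΦ 1 one_pos
      exact ne_top_of_le_ne_top (EReal.coe_ne_top _) (hweak x hx)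
    · refine le_antisymm (le_iInf₂ fun x hx => ?_) (le_iInf₂ fun Φ hΦ => ?_)
      · exact (iInf₂_le x.Φ hx.2.2.2.2.2.2).trans (hweak x hx)
      · rw [hvalue Φ hΦ]
        exact biInf_mono fun x hx => hx.1
    · rintro x ⟨hx, hxmin⟩
      refine ⟨hx.2.2.2.2.2.2, fun Ψ hΨ => ?_⟩
      change pb.worstCase x.Φ ≤ pb.worstCase Ψ
      rw [hvalue Ψ hΨ]
      exact le_iInf₂ fun y hy => (hweak x hx).trans (EReal.coe_le_coe_iff.mpr (hxmin hy.1))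
    · intro hΦ δ hδ
      obtain ⟨x, hx, hxΦ, hle⟩ := hstrong Φ hΦ.1 δ hδ
      refine ⟨x, hx, hxΦ, fun y hy => ?_⟩
      rw [← EReal.coe_le_coe_iff, EReal.coe_add]
      exact hle.trans (add_le_add_left (hopt Φ hΦ y hy) _)
    · intro h
      obtain ⟨x₀, hx₀, rfl, -⟩ := h 1 one_pos
      refine ⟨hx₀.2.2.2.2.2.2, fun Ψ hΨ => ?_⟩
      change pb.worstCase x₀.Φ ≤ pb.worstCase Ψ
      rw [hvalue Ψ hΨ]
      refine le_iInf₂ fun y hy => EReal.le_of_forall_lt_iff_le.mp fun z hz => ?_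
      rw [EReal.coe_lt_coe_iff] at hz
      -- The near-minimizer may change with the slack, but its `Φ`-component does not, so weak
      -- duality bounds the same worst case each time.
      obtain ⟨x, hx, hxΦ, hle⟩ := h (z - pb.objective y) (sub_pos.mpr hz)
      have hxy := hle y hy.1
      rw [add_sub_cancel] at hxy
      rw [← hxΦ]
      exact (hweak x hx).trans (EReal.coe_le_coe_iff.mpr hxy)
    · intro hlt Φ hΦ h0
      obtain ⟨x, hx, hxΦ, hle⟩ :=
        pb.exists_objective_le_worstCase hn hD hSigma hρ hε hlt hΦ.1 h0
      exact ⟨x, ⟨hx.1, fun y hy => EReal.coe_le_coe_iff.mp (hle.trans (hopt Φ hΦ y hy))⟩, hxΦ⟩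
  · refine le_antisymm (le_iInf₂ fun x hx => ?_) (biInf_mono fun x hx => hx.1)
    exact iInf₂_le_of_le { x with Q := pb.costMatrix x.Φ } (hexact x hx) le_rfl
  · rintro x ⟨hx, hxmin⟩
    exact ⟨hexact x hx, fun y hy => hxmin hy.1⟩
  · rintro x ⟨hx, hxmin⟩
    refine ⟨hx.1, fun y hy => ?_⟩
    have h : pb.objective x ≤ pb.objective { y with Q := pb.costMatrix y.Φ } :=
      hxmin (hexact y hy)
    exact h
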